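/- Let $A \subset D$ be a unital inclusion of unital C*-algebras with a faithful conditional expectation $E : D \to A$, and assume $A \neq 0$ has trivial center, $\mathcal Z(A) = \mathbb C 1$. A (right) $A$-$A$-correspondence is a right Hilbert $A$-module with a unital $*$-homomorphism from $A$ to its adjointable operators. Let $\mathcal E$ be the correspondence obtained by completing $D$ for $\langle x, y\rangle = E(x^*y)$, let $\mathrm{Hom}_{A-A}(K,L)$ be the space of adjointable $A$-$A$-bilinear maps, and $\mathrm{End}_{A-A}(K) = \mathrm{Hom}_{A-A}(K,K)$. Let $\mathsf{Bim}_{\mathsf{fgp}}(A)$ be the category of those correspondences that are finitely generated projective as right $A$-modules and bi-Hilbertian, i.e. that carry a left $A$-valued inner product, with the right action by adjointable operators, inducing the same topology. Let $\mathrm{Irr}(A)$ be a set of representatives of the isomorphism classes of $K \in \mathsf{Bim}_{\mathsf{fgp}}(A)$ with $\mathrm{End}_{A-A}(K) = \mathbb C$. For $K \in \mathrm{Irr}(A)$, $H_{\mathcal E}(K) := \mathrm{Hom}_{A-A}(K, \mathcal E)$ is a Hilbert space for $\langle f, g\rangle = f^*g \in \mathrm{End}_{A-A}(K) = \mathbb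 C$. For a family $H = (H(K))_{K \in \mathrm{Irr}(A)}$ of Hilbert spaces put $|H| := \bigoplus^{\ell^2}_{K \in \mathrm{Irr}(A)} K \otimes H(K)$; a correspondence belongs to $\mathsf{Hilb}(\mathsf{Bim}_{\mathsf{fgp}}(A))$ if it is unitarily isomorphic to some $|H|$. The inclusion is called an ind-inclusion if $\mathcal E \cong |H_{\mathcal E}|$ as correspondences. The following are equivalent. (i) $A \subset D$ (with $E$) is an ind-inclusion. (ii) There is a family $(P_i)_{i \in I}$ of mutually orthogonal central projections in $\mathrm{End}_{A-A}(\mathcal E)$ such that: (1) $\sum_i P_i$ converges strictly to $\mathrm{id}_{\mathcal E}$; (2) for each $i$ there is a Hilbert space $H_i$ (possibly zero) with $P_i\,\mathrm{End}_{A-A}(\mathcal E) \cong \mathcal B(H_i)$ as $*$-algebras; (3) for every projection $P \in \mathrm{End}_{A-A}(\mathcal E)$, $P(\mathcal E)$ belongs to $\mathsf{Hilb}(\mathsf{Bim}_{\mathsf{fgp}}(A))$. Moreover, if $A \subset D$ is an ind-inclusion, then $\mathrm{End}_{A-A}(\mathcal E) \cong \prod^{\ell^\infty}_{K \in \mathrm{Irr}(A)}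 \mathcal B(H_{\mathcal E}(K))$ as $*$-algebras. -/

import Mathlib

universe u v w z

namespace CStarCorr

noncomputable section

open scoped TensorProduct ComplexOrder ENNReal

/-- An `A`-`A`-bimodule with an `A`-valued right (semi-definite) inner product, linear in the second
variable, for which the left action is by `⋆`-adjointable operators. The right action is a module
structure over `Aᵐᵒᵖ`: `x ◁ a` is `MulOpposite.op a • x`. (Mathlib's `CStarModule` is the notion for
left modules.) -/
structure PreCorr (A : Type u) [CStarAlgebra A] [PartialOrder A] [StarOrderedRing A] where
  carrier : Type v
  [addCommGroup : AddCommGroup carrier]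
  [module : Module ℂ carrier]
  [leftModule : Module A carrier]
  [rightModule : Module Aᵐᵒᵖ carrier]
  [leftTower : IsScalarTower ℂ A carrier]
  [rightTower : IsScalarTower ℂ Aᵐᵒᵖ carrier]
  [bimodule : SMulCommClass A Aᵐᵒᵖ carrier]
  ip : carrier → carrier → A
  ip_add_right : ∀ x y z, ip x (y + z) = ip x y + ip x z
  ip_smul_right : ∀ (c : ℂ) x y, ip x (c • y) = c • ip x y
  ip_op_smul_right : ∀ (a : A) x y, ip x (MulOpposite.op a • y) = ip x y * a
  star_ip : ∀ x y, star (ip x y) = ip y x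
  ip_self_nonneg : ∀ x, 0 ≤ ip x x
  ip_left_smul : ∀ (a : A) x y, ip (a • x) y = ip x (star a • y)

attribute [instance] PreCorr.addCommGroup PreCorr.module PreCorr.leftModule PreCorr.rightModule
  PreCorr.leftTower PreCorr.rightTower PreCorr.bimodule

variable {A : Type u} [CStarAlgebra A] [PartialOrder A] [StarOrderedRing A]

namespace PreCorr

instance : CoeSort (PreCorr.{u, v} A) (Type v) := ⟨PreCorr.carrier⟩

variable (V : PreCorr.{u, v} A)

/-- The inner product as a sesquilinear map. -/
def ipₛₗ : V →ₗ⋆[ℂ] V →ₗ[ℂ] A where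
  toFun x :=
    { toFun := V.ip x
      map_add' := V.ip_add_right x
      map_smul' := fun c y => V.ip_smul_right c x y }
  map_add' x y := by
    ext z
    change V.ip (x + y) z = V.ip x z + V.ip y z
    rw [← V.star_ip, V.ip_add_right, star_add, V.star_ip, V.star_ip]
  map_smul' c x := by
    ext z
    change V.ip (c • x) z = star c • V.ip x z
    rw [← V.star_ip, V.ip_smul_right, star_smul, V.star_ip]

theorem ipₛₗ_apply (x y : V) : V.ipₛₗ x y = V.ip x y := rfl

theorem ip_add_left (x y z : V) : V.ip (x + y) z = V.ip x z + V.ip y z := by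
  simp only [← ipₛₗ_apply, map_add, LinearMap.add_apply]

theorem ip_smul_left (c : ℂ) (x y : V) : V.ip (c • x) y = star c • V.ip x y := by
  simp only [← ipₛₗ_apply, map_smulₛₗ, LinearMap.smul_apply]; rfl

theorem ip_sub_left (x y z : V) : V.ip (x - y) z = V.ip x z - V.ip y z := by
  simp only [← ipₛₗ_apply, map_sub, LinearMap.sub_apply]

theorem ip_sub_right (x y z : V) : V.ip x (y - z) = V.ip x y - V.ip x z := by
  simp only [← ipₛₗ_apply, map_sub]

theorem ip_op_smul_left (a : A) (x y : V) :
    V.ip (MulOpposite.op a • x) y = star a * V.ip x y := by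
  rw [← V.star_ip, V.ip_op_smul_right, star_mul, V.star_ip]

/-- The (semi-)norm `‖x‖ = ‖⟨x, x⟩‖ ^ (1/2)`. -/
instance : Norm V := ⟨fun x => √‖V.ip x x‖⟩

theorem norm_def (x : V) : ‖x‖ = √‖V.ip x x‖ := rfl

theorem norm_sq (x : V) : ‖x‖ ^ 2 = ‖V.ip x x‖ := by
  rw [norm_def, Real.sq_sqrt (norm_nonneg _)]

theorem ip_mul_ip_le (x y : V) {t : ℝ} (ht : 0 < t) (hx : ‖V.ip x x‖ ≤ t) :
    V.ip y x * V.ip x y ≤ t • V.ip y y := by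
  have hsm : ∀ (r : ℝ) (z w : V), V.ip z (((r : ℂ)) • w) = r • V.ip z w := fun r z w => by
    rw [V.ip_smul_right]; simp
  have hsm' : ∀ (r : ℝ) (z w : V), V.ip (((r : ℂ)) • z) w = r • V.ip z w := fun r z w => by
    rw [V.ip_smul_left]; simp
  set a := V.ip x y with ha
  have hya : V.ip y x = star a := (V.star_ip x y).symm
  have h0 := V.ip_self_nonneg (MulOpposite.op a • x - (t : ℂ) • y)
  have h1 : V.ip (MulOpposite.op a • x - (t : ℂ) • y) (MulOpposite.op a • x - (t : ℂ) • y)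
      = star a * V.ip x x * a - (2 * t) • (star a * a) + t • (t • V.ip y y) := by
    simp only [ip_sub_left, ip_sub_right, hsm, hsm', ip_op_smul_left, ip_op_smul_right, ← ha, hya,
      sub_mul, smul_sub, smul_mul_assoc, mul_assoc, two_mul, add_smul]
    abel
  have h2 : star a * V.ip x x * a ≤ t • (star a * a) := by
    calc _ ≤ ‖V.ip x x‖ • (star a * a) :=
          CStarAlgebra.star_left_conjugate_le_norm_smul (hb := IsSelfAdjoint.of_nonneg (V.ip_self_nonneg x))
      _ ≤ _ := by
          have := star_mul_self_nonneg a
          gcongr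
  rw [h1] at h0
  have h3 : (0 : A) ≤ t • (t • V.ip y y - star a * a) := by
    calc (0 : A) ≤ _ := h0
      _ ≤ t • (star a * a) - (2 * t) • (star a * a) + t • (t • V.ip y y) := by gcongr
      _ = _ := by rw [smul_sub, two_mul, add_smul]; abel
  have h4 : t • (star a * a) ≤ t • (t • V.ip y y) := by
    rwa [smul_sub, sub_nonneg] at h3
  rw [hya]
  exact (smul_le_smul_iff_of_pos_left ht).1 h4

theorem norm_ip_le (x y : V) : ‖V.ip x y‖ ≤ ‖x‖ * ‖y‖ := by
  have key : ∀ t : ℝ, ‖V.ip x x‖ < t → ‖V.ip x y‖ ^ 2 ≤ t * ‖V.ip y y‖ := by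
    intro t ht
    have ht0 : 0 < t := (norm_nonneg _).trans_lt ht
    have h := V.ip_mul_ip_le x y ht0 ht.le
    rw [← V.star_ip x y] at h
    have h' := CStarAlgebra.norm_le_norm_of_nonneg_of_le (star_mul_self_nonneg _) h
    rw [CStarRing.norm_star_mul_self, norm_smul, Real.norm_of_nonneg ht0.le] at h'
    rwa [sq]
  have h2 : ‖V.ip x y‖ ^ 2 ≤ ‖V.ip x x‖ * ‖V.ip y y‖ := by
    refine le_of_forall_pos_le_add fun ε hε => ?_
    have h := key (‖V.ip x x‖ + ε / (‖V.ip y y‖ + 1)) (lt_add_of_pos_right _ (by positivity))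
    refine h.trans ?_
    rw [add_mul]
    gcongr
    rw [div_mul_eq_mul_div, div_le_iff₀ (by positivity)]
    nlinarith [norm_nonneg (V.ip y y)]
  rw [norm_def, norm_def, ← Real.sqrt_mul (norm_nonneg _)]
  exact Real.le_sqrt_of_sq_le h2

theorem seminormedCore : SeminormedSpace.Core ℂ V where
  norm_nonneg _ := Real.sqrt_nonneg _
  norm_smul c x := by
    rw [norm_def, norm_def, V.ip_smul_left, V.ip_smul_right, norm_smul, norm_smul, norm_star,
      ← mul_assoc, Real.sqrt_mul (by positivity), Real.sqrt_mul_self (norm_nonneg _)]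
  norm_triangle x y := by
    have hn : ∀ z : V, 0 ≤ ‖z‖ := fun z => Real.sqrt_nonneg _
    refine (pow_le_pow_iff_left₀ (hn _) (add_nonneg (hn _) (hn _)) two_ne_zero).1 ?_
    rw [norm_sq, V.ip_add_left, V.ip_add_right, V.ip_add_right]
    calc _ ≤ (‖V.ip x x‖ + ‖V.ip x y‖) + (‖V.ip y x‖ + ‖V.ip y y‖) :=
          (norm_add_le _ _).trans (add_le_add (norm_add_le _ _) (norm_add_le _ _))
      _ ≤ (‖x‖ ^ 2 + ‖x‖ * ‖y‖) + (‖y‖ * ‖x‖ + ‖y‖ ^ 2) := by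
          rw [norm_sq, norm_sq]
          gcongr <;> exact V.norm_ip_le _ _
      _ = _ := by ring

instance : SeminormedAddCommGroup V := SeminormedAddCommGroup.ofCore V.seminormedCore

instance : NormedSpace ℂ V := ⟨fun c x => (V.seminormedCore.norm_smul c x).le⟩

theorem norm_op_smul_le (a : A) (x : V) : ‖MulOpposite.op a • x‖ ≤ ‖a‖ * ‖x‖ := by
  refine (pow_le_pow_iff_left₀ (norm_nonneg _) (by positivity) two_ne_zero).1 ?_
  rw [norm_sq, mul_pow, norm_sq, V.ip_op_smul_left, V.ip_op_smul_right]
  calc _ ≤ ‖star a‖ * (‖V.ip x x‖ * ‖a‖) :=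
        (norm_mul_le _ _).trans (by gcongr; exact norm_mul_le _ _)
    _ = _ := by rw [norm_star]; ring

theorem norm_left_smul_le (a : A) (x : V) : ‖a • x‖ ≤ ‖a‖ * ‖x‖ := by
  refine (pow_le_pow_iff_left₀ (norm_nonneg _) (by positivity) two_ne_zero).1 ?_
  have h1 : star a * a ≤ algebraMap ℝ A (‖a‖ ^ 2) := by
    have := CStarAlgebra.star_mul_le_algebraMap_norm_sq (a := a)
    exact this
  obtain ⟨b, hb⟩ := (CStarAlgebra.nonneg_iff_eq_star_mul_self).1 (sub_nonneg.2 h1)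
  have h2 : (0 : A) ≤ (‖a‖ ^ 2) • V.ip x x - V.ip (a • x) (a • x) := by
    have h3 : V.ip (b • x) (b • x) = (‖a‖ ^ 2) • V.ip x x - V.ip (a • x) (a • x) := by
      rw [V.ip_left_smul, V.ip_left_smul, smul_smul, smul_smul, ← hb, sub_smul, ip_sub_right]
      congr 1
      have : (algebraMap ℝ A (‖a‖ ^ 2)) • x = ((‖a‖ ^ 2 : ℝ) : ℂ) • x := by
        rw [← algebraMap_smul A ((‖a‖ ^ 2 : ℝ) : ℂ) x]
        rfl
      rw [this, V.ip_smul_right]; exact Complex.coe_smul _ _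
    rw [← h3]; exact V.ip_self_nonneg _
  have h4 := CStarAlgebra.norm_le_norm_of_nonneg_of_le (V.ip_self_nonneg (a • x)) (sub_nonneg.1 h2)
  rw [norm_smul, Real.norm_of_nonneg (by positivity)] at h4
  rwa [norm_sq, mul_pow, norm_sq]

instance : UniformContinuousConstSMul A V :=
  ⟨fun a => (AddMonoidHomClass.uniformContinuous_of_bound (DistribSMul.toAddMonoidHom V a) ‖a‖
    (fun x => V.norm_left_smul_le a x))⟩

instance : UniformContinuousConstSMul Aᵐᵒᵖ V :=
  ⟨fun a => (AddMonoidHomClass.uniformContinuous_of_bound (DistribSMul.toAddMonoidHom V a)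
    ‖a.unop‖ (fun x => V.norm_op_smul_le a.unop x))⟩

theorem continuous_ip : Continuous fun p : V × V => V.ip p.1 p.2 := by
  let f : V →L⋆[ℂ] V →L[ℂ] A := LinearMap.mkContinuous₂ V.ipₛₗ 1 fun x y => by
    simpa [ipₛₗ_apply] using V.norm_ip_le x y
  have : ∀ p : V × V, V.ip p.1 p.2 = f p.1 p.2 := fun p => rfl
  simp_rw [this]
  fun_prop

open UniformSpace

/-- The inner product extended by continuity to the (separated) completion. -/
def completionIp (x y : Completion V) : A :=
  (Completion.isDenseInducing_coe.prodMap Completion.isDenseInducing_coe).extend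
    (fun p : V × V => V.ip p.1 p.2) (x, y)

theorem completionIp_coe (x y : V) : V.completionIp (x : Completion V) (y : Completion V) = V.ip x y :=
  (Completion.isDenseInducing_coe.prodMap Completion.isDenseInducing_coe).extend_eq
    V.continuous_ip (x, y)

theorem continuous_completionIp :
    Continuous fun p : Completion V × Completion V => V.completionIp p.1 p.2 := by
  let ip' : V →+ V →+ A :=
    { toFun := fun x => (V.ipₛₗ x).toAddMonoidHom
      map_zero' := by ext x; simp
      map_add' := fun x y => by ext z; simp }
  have : Continuous fun p : V × V => ip' p.1 p.2 := V.continuous_ip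
  exact (Completion.isDenseInducing_toCompl V).extend_Z_bilin
    (Completion.isDenseInducing_toCompl V) this

theorem continuous_completionIp_comp {X : Type*} [TopologicalSpace X] {f g : X → Completion V}
    (hf : Continuous f) (hg : Continuous g) : Continuous fun x => V.completionIp (f x) (g x) :=
  V.continuous_completionIp.comp (hf.prodMk hg)

theorem completionIp_add_right (x y z : Completion V) :
    V.completionIp x (y + z) = V.completionIp x y + V.completionIp x z := by
  refine Completion.induction_on₃ x y z (isClosed_eq
    (V.continuous_completionIp_comp continuous_fst
      ((continuous_fst.comp continuous_snd).add (continuous_snd.comp continuous_snd)))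
    ((V.continuous_completionIp_comp continuous_fst (continuous_fst.comp continuous_snd)).add
      (V.continuous_completionIp_comp continuous_fst (continuous_snd.comp continuous_snd))))
    fun a b c => ?_
  rw [← Completion.coe_add, completionIp_coe, completionIp_coe, completionIp_coe, V.ip_add_right]

theorem completionIp_smul_right (c : ℂ) (x y : Completion V) :
    V.completionIp x (c • y) = c • V.completionIp x y := by
  refine Completion.induction_on₂ x y (isClosed_eq
    (V.continuous_completionIp_comp continuous_fst (continuous_snd.const_smul c))
    ((V.continuous_completionIp_comp continuous_fst continuous_snd).const_smul c)) fun a b => ?_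
  rw [← Completion.coe_smul, completionIp_coe, completionIp_coe, V.ip_smul_right]

theorem completionIp_op_smul_right (c : A) (x y : Completion V) :
    V.completionIp x (MulOpposite.op c • y) = V.completionIp x y * c := by
  refine Completion.induction_on₂ x y (isClosed_eq
    (V.continuous_completionIp_comp continuous_fst (continuous_snd.const_smul (MulOpposite.op c)))
    ((V.continuous_completionIp_comp continuous_fst continuous_snd).mul continuous_const))
    fun a b => ?_
  rw [← Completion.coe_smul, completionIp_coe, completionIp_coe, V.ip_op_smul_right]

theorem star_completionIp (x y : Completion V) :
    star (V.completionIp x y) = V.completionIp y x := by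
  refine Completion.induction_on₂ x y (isClosed_eq
    (V.continuous_completionIp_comp continuous_fst continuous_snd).star
    (V.continuous_completionIp_comp continuous_snd continuous_fst)) fun a b => ?_
  rw [completionIp_coe, completionIp_coe, V.star_ip]

theorem completionIp_self_nonneg (x : Completion V) : 0 ≤ V.completionIp x x := by
  refine Completion.induction_on x (isClosed_le continuous_const
    (V.continuous_completionIp_comp continuous_id continuous_id)) fun a => ?_
  rw [completionIp_coe]
  exact V.ip_self_nonneg a

theorem completionIp_left_smul (c : A) (x y : Completion V) :
    V.completionIp (c • x) y = V.completionIp x (star c • y) := by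
  refine Completion.induction_on₂ x y (isClosed_eq
    (V.continuous_completionIp_comp (continuous_fst.const_smul c) continuous_snd)
    (V.continuous_completionIp_comp continuous_fst (continuous_snd.const_smul (star c))))
    fun a b => ?_
  rw [← Completion.coe_smul, ← Completion.coe_smul, completionIp_coe, completionIp_coe,
    V.ip_left_smul]

/-- The (separated) completion of `V`, with all operations extended by continuity. -/
def completionPre : PreCorr.{u, v} A where
  carrier := Completion V
  ip := V.completionIp
  ip_add_right := V.completionIp_add_right
  ip_smul_right := V.completionIp_smul_right
  ip_op_smul_right := V.completionIp_op_smul_right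
  star_ip := V.star_completionIp
  ip_self_nonneg := V.completionIp_self_nonneg
  ip_left_smul := V.completionIp_left_smul

theorem completion_norm (x : Completion V) : ‖x‖ = √‖V.completionIp x x‖ := by
  refine Completion.induction_on x (isClosed_eq continuous_norm
    (V.continuous_completionIp_comp continuous_id continuous_id).norm.sqrt) fun a => ?_
  rw [completionIp_coe, Completion.norm_coe, norm_def]

/-- The norm given by the inner product is the norm of the completion. -/
def completionEquiv : Completion V ≃ᵢ V.completionPre where
  toEquiv := Equiv.refl _
  isometry_toFun := by
    let φ : Completion V →+ V.completionPre :=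
      { toFun := fun x => x
        map_zero' := rfl
        map_add' := fun _ _ => rfl }
    exact AddMonoidHomClass.isometry_of_norm φ fun x => (V.completion_norm x).symm

end PreCorr

/-- `V` is complete for the norm `‖x‖ = ‖⟨x, x⟩‖ ^ (1/2)`. -/
def PreCorr.IsComplete (V : PreCorr.{u, v} A) : Prop := CompleteSpace V

/-- A right `A`-`A`-correspondence: a right Hilbert `A`-module, with a unital `⋆`-homomorphism from
`A` to its adjointable operators. Since `A` and the action are unital, it is non-degenerate. -/
structure Corr (A : Type u) [CStarAlgebra A] [PartialOrder A] [StarOrderedRing A] extends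
    PreCorr.{u, v} A where
  definite : ∀ x, ip x x = 0 → x = 0
  complete : toPreCorr.IsComplete

/-- The correspondence obtained from `V` by separation and completion. -/
def PreCorr.completion (V : PreCorr.{u, v} A) : Corr.{u, v} A where
  toPreCorr := V.completionPre
  definite x hx := by
    have h := V.completion_norm x
    have hx' : V.completionIp x x = 0 := hx
    rw [hx', norm_zero, Real.sqrt_zero] at h
    exact norm_eq_zero.1 h
  complete := V.completionEquiv.symm.completeSpace

namespace Corr

instance : CoeSort (Corr.{u, v} A) (Type v) := ⟨fun K => K.carrier⟩

instance (K : Corr.{u, v} A) : CompleteSpace K := K.complete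

variable {K : Corr.{u, v} A} {L : Corr.{u, w} A}

theorem norm_eq_zero_iff {x : K} : ‖x‖ = 0 ↔ x = 0 := by
  refine ⟨fun h => K.definite x ?_, fun h => by rw [h, norm_zero]⟩
  rwa [← norm_eq_zero, ← PreCorr.norm_sq, sq_eq_zero_iff]

instance : NormedAddCommGroup K :=
  NormedAddCommGroup.ofSeparation fun _ h => norm_eq_zero_iff.1 h

theorem ext_ip {x y : K} (h : ∀ z, K.ip z x = K.ip z y) : x = y := by
  rw [← sub_eq_zero]
  refine K.definite _ ?_
  rw [PreCorr.ip_sub_right, sub_eq_zero]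
  exact h _

/-- `f` is an `A`-`A`-bilinear map admitting an adjoint. -/
def IsMorphism (f : K →ₗ[ℂ] L) : Prop :=
  (∀ (a : A) x, f (a • x) = a • f x) ∧
  (∀ (a : A) x, f (MulOpposite.op a • x) = MulOpposite.op a • f x) ∧
  ∃ g : L → K, ∀ x y, L.ip (f x) y = K.ip x (g y)

end Corr

namespace Corr

variable (K : Corr.{u, v} A) (L : Corr.{u, w} A)

/-- The space of adjointable `A`-`A`-bilinear maps from `K` to `L`. -/
def homSpace : Submodule ℂ (K →ₗ[ℂ] L) where
  carrier := {f | IsMorphism f}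
  add_mem' := by
    rintro f g ⟨hf, hf', f', hff⟩ ⟨hg, hg', g', hgg⟩
    refine ⟨fun a x => ?_, fun a x => ?_, fun y => f' y + g' y, fun x y => ?_⟩
    · rw [LinearMap.add_apply, LinearMap.add_apply, hf, hg, smul_add]
    · rw [LinearMap.add_apply, LinearMap.add_apply, hf', hg', smul_add]
    · rw [LinearMap.add_apply, PreCorr.ip_add_left, hff, hgg, PreCorr.ip_add_right]
  zero_mem' := by
    refine ⟨fun a x => ?_, fun a x => ?_, fun y => 0, fun x y => ?_⟩
    · simp
    · simp
    · simp [← PreCorr.ipₛₗ_apply]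
  smul_mem' := by
    rintro c f ⟨hf, hf', f', hff⟩
    refine ⟨fun a x => ?_, fun a x => ?_, fun y => star c • f' y, fun x y => ?_⟩
    · rw [LinearMap.smul_apply, LinearMap.smul_apply, hf, smul_comm]
    · rw [LinearMap.smul_apply, LinearMap.smul_apply, hf', smul_comm]
    · rw [LinearMap.smul_apply, PreCorr.ip_smul_left, hff, PreCorr.ip_smul_right]

/-- The algebra of adjointable `A`-`A`-bilinear endomorphisms of `K`. -/
def endAlg : Subalgebra ℂ (Module.End ℂ K) where
  carrier := {f | IsMorphism f}
  add_mem' := (homSpace K K).add_mem'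
  mul_mem' := by
    rintro f g ⟨hf, hf', f', hff⟩ ⟨hg, hg', g', hgg⟩
    refine ⟨fun a x => ?_, fun a x => ?_, fun y => g' (f' y), fun x y => ?_⟩
    · rw [Module.End.mul_apply, Module.End.mul_apply, hg, hf]
    · rw [Module.End.mul_apply, Module.End.mul_apply, hg', hf']
    · rw [Module.End.mul_apply, hff, hgg]
  algebraMap_mem' c := by
    refine ⟨fun a x => ?_, fun a x => ?_, fun y => star c • y, fun x y => ?_⟩
    · simp only [Module.algebraMap_end_apply]; rw [smul_comm]
    · simp only [Module.algebraMap_end_apply]; rw [smul_comm]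
    · rw [Module.algebraMap_end_apply, PreCorr.ip_smul_left, PreCorr.ip_smul_right]

variable {K L}

theorem exists_adj (f : homSpace K L) : ∃ g : L → K, ∀ x y, L.ip (f.1 x) y = K.ip x (g y) :=
  f.2.2.2

/-- The adjoint of a morphism, as a function. -/
def adjFun (f : homSpace K L) : L → K := (exists_adj f).choose

theorem ip_adjFun (f : homSpace K L) (x : K) (y : L) :
    K.ip x (adjFun f y) = L.ip (f.1 x) y :=
  ((exists_adj f).choose_spec x y).symm

/-- The adjoint of a morphism. -/
def adj (f : homSpace K L) : homSpace L K :=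
  ⟨{  toFun := adjFun f
      map_add' := fun x y => ext_ip fun z => by
        rw [ip_adjFun, PreCorr.ip_add_right, PreCorr.ip_add_right, ip_adjFun, ip_adjFun]
      map_smul' := fun c x => ext_ip fun z => by
        rw [ip_adjFun, PreCorr.ip_smul_right, RingHom.id_apply, PreCorr.ip_smul_right,
          ip_adjFun] },
    fun a x => ext_ip fun z => by
      change K.ip z (adjFun f (a • x)) = K.ip z (a • adjFun f x)
      have h := K.ip_left_smul (star a) z (adjFun f x)
      have h' := L.ip_left_smul (star a) (f.1 z) x
      rw [star_star] at h h'
      rw [ip_adjFun, ← h', ← h, ← f.2.1, ip_adjFun],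
    fun a x => ext_ip fun z => by
      change K.ip z (adjFun f (MulOpposite.op a • x)) = K.ip z (MulOpposite.op a • adjFun f x)
      rw [ip_adjFun, PreCorr.ip_op_smul_right, PreCorr.ip_op_smul_right, ip_adjFun],
    f.1, fun x y => by
      change K.ip (adjFun f x) y = L.ip x (f.1 y)
      rw [← PreCorr.star_ip, ip_adjFun, PreCorr.star_ip]⟩

theorem ip_adj_right (f : homSpace K L) (x : K) (y : L) :
    K.ip x ((adj f).1 y) = L.ip (f.1 x) y :=
  ip_adjFun f x y

theorem adj_eq {f : homSpace K L} {g : homSpace L K}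
    (h : ∀ x y, L.ip (f.1 x) y = K.ip x (g.1 y)) : adj f = g := by
  refine Subtype.ext (LinearMap.ext fun y => ext_ip fun x => ?_)
  rw [ip_adj_right, h]

theorem ip_adj_left (f : homSpace K L) (x : L) (y : K) :
    K.ip ((adj f).1 x) y = L.ip x (f.1 y) := by
  rw [← PreCorr.star_ip, ip_adj_right, PreCorr.star_ip]

instance : StarRing (endAlg K) where
  star f := ⟨(adj (⟨f.1, f.2⟩ : homSpace K K)).1, (adj (⟨f.1, f.2⟩ : homSpace K K)).2⟩
  star_involutive f := Subtype.ext <| LinearMap.ext fun y => ext_ip fun x => by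
    exact (ip_adj_right (adj (⟨f.1, f.2⟩ : homSpace K K)) x y).trans
      (ip_adj_left (⟨f.1, f.2⟩ : homSpace K K) x y)
  star_mul f g := Subtype.ext <| LinearMap.ext fun y => ext_ip fun x => by
    refine (ip_adj_right (⟨(f * g).1, (f * g).2⟩ : homSpace K K) x y).trans ?_
    refine Eq.trans ?_ (ip_adj_right (⟨g.1, g.2⟩ : homSpace K K) x _).symm
    exact (ip_adj_right (⟨f.1, f.2⟩ : homSpace K K) (g.1 x) y).symm
  star_add f g := Subtype.ext <| LinearMap.ext fun y => ext_ip fun x => by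
    refine (ip_adj_right (⟨(f + g).1, (f + g).2⟩ : homSpace K K) x y).trans ?_
    refine (PreCorr.ip_add_left _ _ _ _).trans ?_
    refine Eq.trans ?_ (PreCorr.ip_add_right _ _ _ _).symm
    exact congrArg₂ _ (ip_adj_right (⟨f.1, f.2⟩ : homSpace K K) x y).symm
      (ip_adj_right (⟨g.1, g.2⟩ : homSpace K K) x y).symm

theorem ip_star_right (f : endAlg K) (x y : K) : K.ip x ((star f).1 y) = K.ip (f.1 x) y :=
  ip_adj_right (⟨f.1, f.2⟩ : homSpace K K) x y

instance : StarModule ℂ (endAlg K) where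
  star_smul c f := Subtype.ext <| LinearMap.ext fun y => ext_ip fun x => by
    refine (ip_star_right (c • f) x y).trans ?_
    refine (PreCorr.ip_smul_left _ _ _ _).trans ?_
    refine Eq.trans ?_ (PreCorr.ip_smul_right _ _ _ _).symm
    exact congrArg _ (ip_star_right f x y).symm

/-- Strict convergence of the net of finite partial sums of `∑ i, P i` to `T`: pointwise norm
convergence of the operators and of their adjoints. -/
def StrictHasSum {ι : Type*} (P : ι → endAlg K) (T : endAlg K) : Prop :=
  (∀ x : K, HasSum (fun i => (P i).1 x) (T.1 x)) ∧
  (∀ x : K, HasSum (fun i => (star (P i)).1 x) ((star T).1 x))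

/-- The corner `P · End_{A-A}(K) · P`, a `⋆`-algebra with unit `P`. If `P` is central, it is
`P · End_{A-A}(K)`. -/
def corner (P : endAlg K) (hP : IsStarProjection P) : NonUnitalStarSubalgebra ℂ (endAlg K) where
  carrier := {T | P * T = T ∧ T * P = T}
  add_mem' := by
    rintro S T ⟨hS, hS'⟩ ⟨hT, hT'⟩
    exact ⟨by rw [mul_add, hS, hT], by rw [add_mul, hS', hT']⟩
  zero_mem' := ⟨mul_zero _, zero_mul _⟩
  mul_mem' := by
    rintro S T ⟨hS, hS'⟩ ⟨hT, hT'⟩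
    exact ⟨by rw [← mul_assoc, hS], by rw [mul_assoc, hT']⟩
  smul_mem' := by
    rintro c T ⟨hT, hT'⟩
    exact ⟨by rw [mul_smul_comm, hT], by rw [smul_mul_assoc, hT']⟩
  star_mem' := by
    rintro T ⟨hT, hT'⟩
    have h : star P = P := hP.isSelfAdjoint
    refine ⟨?_, ?_⟩
    · have := congrArg star hT'
      rwa [star_mul, h] at this
    · have := congrArg star hT
      rwa [star_mul, h] at this

section range

variable (P : endAlg K)

instance : Module A (LinearMap.range P.1) where
  smul a x := ⟨a • x.1, by obtain ⟨y, hy⟩ := x.2; exact ⟨a • y, by rw [P.2.1, hy]⟩⟩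
  one_smul x := Subtype.ext (one_smul A x.1)
  mul_smul a b x := Subtype.ext (mul_smul a b x.1)
  smul_zero a := Subtype.ext (smul_zero a)
  smul_add a x y := Subtype.ext (smul_add a x.1 y.1)
  add_smul a b x := Subtype.ext (add_smul a b x.1)
  zero_smul x := Subtype.ext (zero_smul A x.1)

instance : Module Aᵐᵒᵖ (LinearMap.range P.1) where
  smul a x := ⟨a • x.1, by
    obtain ⟨y, hy⟩ := x.2
    exact ⟨a • y, by rw [← MulOpposite.op_unop a, P.2.2.1, hy]⟩⟩
  one_smul x := Subtype.ext (one_smul Aᵐᵒᵖ x.1)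
  mul_smul a b x := Subtype.ext (mul_smul a b x.1)
  smul_zero a := Subtype.ext (smul_zero a)
  smul_add a x y := Subtype.ext (smul_add a x.1 y.1)
  add_smul a b x := Subtype.ext (add_smul a b x.1)
  zero_smul x := Subtype.ext (zero_smul Aᵐᵒᵖ x.1)

/-- The range of an endomorphism, with the structure inherited from `K`. -/
def rangePre : PreCorr.{u, v} A where
  carrier := LinearMap.range P.1
  leftTower := ⟨fun c a x => Subtype.ext (smul_assoc c a x.1)⟩
  rightTower := ⟨fun c a x => Subtype.ext (smul_assoc c a x.1)⟩
  bimodule := ⟨fun a b x => Subtype.ext (smul_comm a b x.1)⟩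
  ip x y := K.ip x.1 y.1
  ip_add_right _ _ _ := PreCorr.ip_add_right _ _ _ _
  ip_smul_right _ _ _ := PreCorr.ip_smul_right _ _ _ _
  ip_op_smul_right _ _ _ := PreCorr.ip_op_smul_right _ _ _ _
  star_ip _ _ := PreCorr.star_ip _ _ _
  ip_self_nonneg _ := PreCorr.ip_self_nonneg _ _
  ip_left_smul _ _ _ := PreCorr.ip_left_smul _ _ _ _

variable {P}

theorem norm_projection_le (hP : IsStarProjection P) (x : K) : ‖P.1 x‖ ≤ ‖x‖ := by
  have h1 : ‖P.1 x‖ ^ 2 ≤ ‖x‖ * ‖P.1 x‖ := by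
    have h : K.ip (P.1 x) (P.1 x) = K.ip x (P.1 x) := by
      have h2 : star P = P := hP.isSelfAdjoint
      have h3 : P.1 (P.1 x) = P.1 x := by
        have := congrArg (fun Q : endAlg K => Q.1 x) hP.isIdempotentElem
        exact this
      rw [← ip_star_right, h2, h3]
    rw [PreCorr.norm_sq, show K.toPreCorr.ip (P.1 x) (P.1 x) = K.toPreCorr.ip x (P.1 x) from h]
    exact PreCorr.norm_ip_le _ _ _
  by_contra! hlt
  nlinarith [norm_nonneg x]

/-- The range of a projection in `End_{A-A}(K)`, as a subcorrespondence of `K`. -/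
def range (P : endAlg K) (hP : IsStarProjection P) : Corr.{u, v} A where
  toPreCorr := rangePre P
  definite x hx := Subtype.ext (K.definite _ hx)
  complete := by
    let φ : rangePre P →+ K :=
      { toFun := fun x => Subtype.val (p := fun y => y ∈ LinearMap.range P.1) x
        map_zero' := rfl
        map_add' := fun _ _ => rfl }
    have hφ : Isometry φ := AddMonoidHomClass.isometry_of_norm φ fun x => rfl
    change CompleteSpace (rangePre P)
    rw [completeSpace_iff_isComplete_range hφ.isUniformInducing]
    have hcont : Continuous P.1 :=
      AddMonoidHomClass.continuous_of_bound P.1 1 fun x => by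
        rw [one_mul]; exact norm_projection_le hP x
    have hset : Set.range φ = {x | P.1 x = x} := by
      ext x
      constructor
      · rintro ⟨⟨y, z, rfl⟩, rfl⟩
        exact congrArg (fun Q : endAlg K => Q.1 z) hP.isIdempotentElem
      · intro hx
        exact ⟨⟨x, x, hx⟩, rfl⟩
    rw [hset]
    exact (isClosed_eq hcont continuous_id).isComplete

end range

variable (K L)

/-- Unitary isomorphism of correspondences. -/
def UnitarilyEquiv : Prop :=
  ∃ U : K ≃ₗ[ℂ] L, (∀ (a : A) x, U (a • x) = a • U x) ∧
    (∀ (a : A) x, U (MulOpposite.op a • x) = MulOpposite.op a • U x) ∧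
    ∀ x y, L.ip (U x) (U y) = K.ip x y

/-- A left `A`-valued inner product on `K`, making `K` a left inner product `A`-module on which the
right action of `A` is by `⋆`-adjointable operators. -/
structure LeftInnerProduct where
  lip : K → K → A
  lip_add_left : ∀ x y z, lip (x + y) z = lip x z + lip y z
  lip_smul_left : ∀ (a : A) x y, lip (a • x) y = a * lip x y
  star_lip : ∀ x y, star (lip x y) = lip y x
  lip_self_nonneg : ∀ x, 0 ≤ lip x x
  lip_self_eq_zero : ∀ x, lip x x = 0 → x = 0
  lip_op_smul_left : ∀ (a : A) x y,
    lip (MulOpposite.op a • x) y = lip x (MulOpposite.op (star a) • y)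

/-- `K` is bi-Hilbertian: it has a left inner product that induces the same topology as the right
one (for norms on a vector space: the two norms are equivalent). -/
def IsBiHilbertian : Prop :=
  ∃ S : LeftInnerProduct K, ∃ c C : ℝ, 0 < c ∧ 0 < C ∧
    ∀ x, c * ‖x‖ ≤ √‖S.lip x x‖ ∧ √‖S.lip x x‖ ≤ C * ‖x‖

/-- `K` is an object of `Bim_fgp(A)`: bi-Hilbertian, and finitely generated projective as a right
`A`-module. -/
structure IsBimFgp : Prop where
  biHilbertian : IsBiHilbertian K
  finite : Module.Finite Aᵐᵒᵖ K
  projective : Module.Projective Aᵐᵒᵖ K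

/-- `End_{A-A}(K) = ℂ`. -/
structure IsIrreducible : Prop where
  nontrivial : Nontrivial K
  scalar : ∀ f : homSpace K K, ∃ c : ℂ, ∀ x, f.1 x = c • x

end Corr

variable (A) in
/-- The irreducible objects of `Bim_fgp(A)`. A finitely generated right `A`-module is in bijection
with a quotient of some `A ^ n`, so that carriers in the universe of `A` suffice. -/
structure IrrObj where
  corr : Corr.{u, u} A
  fgp : corr.IsBimFgp
  irreducible : corr.IsIrreducible

/-- Two irreducible objects are identified if they are unitarily isomorphic. -/
instance IrrObj.setoid : Setoid (IrrObj.{u} A) where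
  r K L := Corr.UnitarilyEquiv K.corr L.corr
  iseqv :=
    { refl := fun K => ⟨LinearEquiv.refl ℂ _, fun _ _ => rfl, fun _ _ => rfl, fun _ _ => rfl⟩
      symm := by
        rintro K L ⟨U, h1, h2, h3⟩
        refine ⟨U.symm, fun a x => ?_, fun a x => ?_, fun x y => ?_⟩
        · apply U.injective; rw [h1, U.apply_symm_apply, U.apply_symm_apply]
        · apply U.injective; rw [h2, U.apply_symm_apply, U.apply_symm_apply]
        · rw [← h3, U.apply_symm_apply, U.apply_symm_apply]
      trans := by
        rintro K L M ⟨U, h1, h2, h3⟩ ⟨V, g1, g2, g3⟩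
        refine ⟨U.trans V, fun a x => ?_, fun a x => ?_, fun x y => ?_⟩
        · simp only [LinearEquiv.trans_apply, h1, g1]
        · simp only [LinearEquiv.trans_apply, h2, g2]
        · simp only [LinearEquiv.trans_apply, h3, g3] }

variable (A) in
/-- `Irr(A)`, the set of isomorphism classes of irreducible objects of `Bim_fgp(A)`. -/
def Irr : Type (u + 1) := Quotient (IrrObj.setoid (A := A))

/-- A representative of an isomorphism class. -/
def Irr.rep (k : Irr A) : IrrObj A := Quotient.out k

/-- `Hom_{A-A}(K, E)` for `K` irreducible. It is a Hilbert space below, `⟨f, g⟩` being the scalar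
`f* g` in `End_{A-A}(K) = ℂ`. -/
def HilbHom (K : IrrObj A) (E : Corr.{u, v} A) : Type (max u v) := Corr.homSpace K.corr E

namespace HilbHom

open Corr

variable {K : IrrObj A} {E : Corr.{u, v} A}

instance : AddCommGroup (HilbHom K E) := inferInstanceAs (AddCommGroup (Corr.homSpace K.corr E))
instance : Module ℂ (HilbHom K E) := inferInstanceAs (Module ℂ (Corr.homSpace K.corr E))

/-- An element of `HilbHom K E`, as a morphism of correspondences. -/
def toHom (f : HilbHom K E) : Corr.homSpace K.corr E := f

theorem exists_scalar (f g : HilbHom K E) :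
    ∃ c : ℂ, ∀ x, (adj f.toHom).1 (g.toHom.1 x) = c • x := by
  refine K.irreducible.scalar ⟨(adj f.toHom).1 ∘ₗ g.toHom.1, fun a x => ?_, fun a x => ?_,
    fun x => (adj g.toHom).1 (f.toHom.1 x), fun x y => ?_⟩
  · rw [LinearMap.comp_apply, g.toHom.2.1, (adj f.toHom).2.1]; rfl
  · rw [LinearMap.comp_apply, g.toHom.2.2.1, (adj f.toHom).2.2.1]; rfl
  · rw [LinearMap.comp_apply, ip_adj_left, ip_adj_right]

instance : Inner ℂ (HilbHom K E) := ⟨fun f g => (exists_scalar f g).choose⟩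

theorem adj_comp_apply (f g : HilbHom K E) (x : K.corr) :
    (adj f.toHom).1 (g.toHom.1 x) = inner ℂ f g • x :=
  (exists_scalar f g).choose_spec x

theorem ip_apply_apply (f g : HilbHom K E) (x y : K.corr) :
    E.ip (f.toHom.1 x) (g.toHom.1 y) = inner ℂ f g • K.corr.ip x y := by
  rw [← ip_adj_right, adj_comp_apply, PreCorr.ip_smul_right]

theorem exists_ip_ne_zero (K : IrrObj A) : ∃ x : K.corr, K.corr.ip x x ≠ 0 := by
  have := K.irreducible.nontrivial
  obtain ⟨x, hx⟩ := exists_ne (0 : K.corr)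
  exact ⟨x, fun h => hx (K.corr.definite x h)⟩

theorem inner_eq {f g : HilbHom K E} {c : ℂ}
    (h : ∀ x y, E.ip (f.toHom.1 x) (g.toHom.1 y) = c • K.corr.ip x y) : inner ℂ f g = c := by
  obtain ⟨x, hx⟩ := exists_ip_ne_zero K
  have := h x x
  rw [ip_apply_apply] at this
  exact smul_left_injective ℂ hx this

/-- The axioms of an inner product. -/
@[reducible] def core : InnerProductSpace.Core ℂ (HilbHom K E) where
  conj_inner_symm f g := by
    symm
    refine inner_eq fun x y => ?_
    rw [← PreCorr.star_ip, ip_apply_apply, star_smul, PreCorr.star_ip]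
    rfl
  re_inner_nonneg f := by
    obtain ⟨x, hx⟩ := exists_ip_ne_zero K
    set p := K.corr.ip x x with hp
    have hp0 : 0 ≤ p := PreCorr.ip_self_nonneg _ _
    have h1 : 0 ≤ inner ℂ f f • p := by
      rw [hp, ← ip_apply_apply]; exact PreCorr.ip_self_nonneg _ _
    have h2 : inner ℂ f f = ((inner ℂ f f).re : ℂ) := by
      have hs : star (inner ℂ f f) • p = inner ℂ f f • p := by
        have := (IsSelfAdjoint.of_nonneg h1).star_eq
        rwa [star_smul, (IsSelfAdjoint.of_nonneg hp0).star_eq] at this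
      have := smul_left_injective ℂ hx hs
      exact (Complex.conj_eq_iff_re.1 this).symm
    change 0 ≤ (inner ℂ f f).re
    by_contra! hneg
    rw [h2] at h1
    have h3 : 0 ≤ (inner ℂ f f).re • p := by rwa [Complex.coe_smul] at h1
    have h4 : (inner ℂ f f).re • p ≤ 0 := smul_nonpos_of_nonpos_of_nonneg hneg.le hp0
    rcases smul_eq_zero.1 (le_antisymm h4 h3) with h | h
    · exact hneg.ne h
    · exact hx h
  add_left f g h := by
    refine inner_eq fun x y => ?_
    rw [add_smul, ← ip_apply_apply, ← ip_apply_apply, ← PreCorr.ip_add_left]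
    rfl
  smul_left f g c := by
    refine inner_eq fun x y => ?_
    rw [mul_smul, ← ip_apply_apply]
    exact PreCorr.ip_smul_left _ _ _ _
  definite f hf := by
    refine Subtype.ext (LinearMap.ext fun x => E.definite _ ?_)
    have := ip_apply_apply f f x x
    rw [hf, zero_smul] at this
    exact this

instance : NormedAddCommGroup (HilbHom K E) := core.toNormedAddCommGroup

instance : InnerProductSpace ℂ (HilbHom K E) := InnerProductSpace.ofCore core.toCore

theorem norm_apply (f : HilbHom K E) (x : K.corr) : ‖f.toHom.1 x‖ = ‖f‖ * ‖x‖ := by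
  refine (pow_left_inj₀ (norm_nonneg _) (by positivity) two_ne_zero).1 ?_
  rw [mul_pow, PreCorr.norm_sq, PreCorr.norm_sq]
  have h := ip_apply_apply f f x x
  change E.toPreCorr.ip _ _ = _ at h
  rw [h, norm_smul, inner_self_eq_norm_sq_to_K]
  simp

theorem norm_adj_apply_le (f : HilbHom K E) (y : E) : ‖(adj f.toHom).1 y‖ ≤ ‖f‖ * ‖y‖ := by
  have h1 : ‖(adj f.toHom).1 y‖ ^ 2 ≤ (‖f‖ * ‖(adj f.toHom).1 y‖) * ‖y‖ := by
    rw [PreCorr.norm_sq, ← norm_apply]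
    have h := ip_adj_right f.toHom ((adj f.toHom).1 y) y
    change K.corr.toPreCorr.ip _ _ = _ at h
    rw [h]
    exact PreCorr.norm_ip_le _ _ _
  by_contra! hlt
  have : 0 ≤ ‖f‖ * ‖y‖ := by positivity
  nlinarith

theorem adj_sub_apply (f g : HilbHom K E) (y : E) :
    (adj (f - g).toHom).1 y = (adj f.toHom).1 y - (adj g.toHom).1 y := by
  refine ext_ip fun x => ?_
  rw [ip_adj_right, PreCorr.ip_sub_right]
  refine Eq.trans ?_ (congrArg₂ _ (ip_adj_right f.toHom x y).symm (ip_adj_right g.toHom x y).symm)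
  exact PreCorr.ip_sub_left _ _ _ _

open Filter Topology in
instance : CompleteSpace (HilbHom K E) := by
  refine Metric.complete_of_cauchySeq_tendsto fun F hF => ?_
  have hF1 : ∀ x, CauchySeq fun n => (F n).toHom.1 x := fun x => by
    rw [Metric.cauchySeq_iff'] at hF ⊢
    intro ε hε
    obtain ⟨N, hN⟩ := hF (ε / (‖x‖ + 1)) (by positivity)
    refine ⟨N, fun n hn => ?_⟩
    have h := hN n hn
    rw [dist_eq_norm] at h ⊢
    have h2 : (F n).toHom.1 x - (F N).toHom.1 x = (F n - F N).toHom.1 x := rfl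
    rw [h2, norm_apply]
    rw [lt_div_iff₀ (by positivity)] at h
    nlinarith [norm_nonneg (F n - F N), norm_nonneg x]
  have hF2 : ∀ y, CauchySeq fun n => (adj (F n).toHom).1 y := fun y => by
    rw [Metric.cauchySeq_iff'] at hF ⊢
    intro ε hε
    obtain ⟨N, hN⟩ := hF (ε / (‖y‖ + 1)) (by positivity)
    refine ⟨N, fun n hn => ?_⟩
    have h := hN n hn
    rw [dist_eq_norm] at h ⊢
    rw [← adj_sub_apply]
    refine (norm_adj_apply_le _ _).trans_lt ?_
    rw [lt_div_iff₀ (by positivity)] at h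
    nlinarith [norm_nonneg (F n - F N), norm_nonneg y]
  choose f hf using fun x => cauchySeq_tendsto_of_complete (hF1 x)
  choose g hg using fun y => cauchySeq_tendsto_of_complete (hF2 y)
  have hmor : IsMorphism (linearMapOfTendsto f (fun n => (F n).toHom.1) (tendsto_pi_nhds.2 hf)) := by
    refine ⟨fun a x => ?_, fun a x => ?_, g, fun x y => ?_⟩
    · refine tendsto_nhds_unique (hf (a • x)) ?_
      simp_rw [(F _).toHom.2.1]
      exact (hf x).const_smul a
    · refine tendsto_nhds_unique (hf (MulOpposite.op a • x)) ?_
      simp_rw [(F _).toHom.2.2.1]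
      exact (hf x).const_smul (MulOpposite.op a)
    · have h1 : Tendsto (fun n => E.ip ((F n).toHom.1 x) y) atTop (𝓝 (E.ip (f x) y)) :=
        (E.toPreCorr.continuous_ip.tendsto (f x, y)).comp ((hf x).prodMk_nhds tendsto_const_nhds)
      have h2 : Tendsto (fun n => K.corr.ip x ((adj (F n).toHom).1 y)) atTop
          (𝓝 (K.corr.ip x (g y))) :=
        (K.corr.toPreCorr.continuous_ip.tendsto (x, g y)).comp
          (tendsto_const_nhds.prodMk_nhds (hg y))
      simp_rw [ip_adj_right] at h2
      exact tendsto_nhds_unique h1 h2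
  let f' : HilbHom K E := ⟨_, hmor⟩
  refine ⟨f', ?_⟩
  obtain ⟨x, hx⟩ := exists_ip_ne_zero K
  have hx0 : ‖x‖ ≠ 0 := fun h => hx (by
    rw [← norm_eq_zero, ← PreCorr.norm_sq, h]; simp)
  have h3 : Tendsto (fun n => ‖F n - f'‖ * ‖x‖) atTop (𝓝 0) := by
    have h4 := (tendsto_iff_norm_sub_tendsto_zero.1 (hf x))
    refine h4.congr fun n => ?_
    rw [← norm_apply]; rfl
  rw [tendsto_iff_norm_sub_tendsto_zero]
  have h5 := h3.mul_const ‖x‖⁻¹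
  simpa [mul_assoc, hx0] using h5

end HilbHom
namespace PreCorr

section tensor

variable (K : PreCorr.{u, v} A) (H : Type w) [NormedAddCommGroup H] [InnerProductSpace ℂ H]

/-- The sesquilinear form on `K ⊙ H` with `⟨x ⊗ h, y ⊗ k⟩ = ⟨h, k⟩ ⟨x, y⟩`. -/
def tensorIp : (K ⊗[ℂ] H) →ₗ⋆[ℂ] (K ⊗[ℂ] H) →ₗ[ℂ] A :=
  (TensorProduct.lift (TensorProduct.mapBilinear (.id ℂ) K H A ℂ)).compr₂
    (TensorProduct.rid ℂ A).toLinearMap ∘ₛₗ TensorProduct.map K.ipₛₗ (innerₛₗ ℂ)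

theorem tensorIp_tmul (x y : K) (h k : H) :
    K.tensorIp H (x ⊗ₜ h) (y ⊗ₜ k) = inner ℂ h k • K.ip x y := rfl

theorem star_tensorIp (x y : K ⊗[ℂ] H) : star (K.tensorIp H x y) = K.tensorIp H y x := by
  induction x with
  | zero => simp
  | add x x' hx hx' => simp [hx, hx']
  | tmul x h =>
    induction y with
    | zero => simp
    | add y y' hy hy' => simp [hy, hy']
    | tmul y k =>
      rw [tensorIp_tmul, tensorIp_tmul, star_smul, K.star_ip]
      congr 1
      exact inner_conj_symm k h

theorem tensorIp_op_smul_right (a : A) (x y : K ⊗[ℂ] H) :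
    K.tensorIp H x (MulOpposite.op a • y) = K.tensorIp H x y * a := by
  induction x with
  | zero => simp
  | add x x' hx hx' => simp [hx, hx', add_mul]
  | tmul x h =>
    induction y with
    | zero => simp
    | add y y' hy hy' => simp [hy, hy', add_mul]
    | tmul y k =>
      rw [TensorProduct.smul_tmul', tensorIp_tmul, tensorIp_tmul, K.ip_op_smul_right,
        smul_mul_assoc]

theorem tensorIp_left_smul (a : A) (x y : K ⊗[ℂ] H) :
    K.tensorIp H (a • x) y = K.tensorIp H x (star a • y) := by
  induction x with
  | zero => simp
  | add x x' hx hx' => simp [hx, hx']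
  | tmul x h =>
    induction y with
    | zero => simp
    | add y y' hy hy' => simp [hy, hy']
    | tmul y k =>
      rw [TensorProduct.smul_tmul', TensorProduct.smul_tmul', tensorIp_tmul, tensorIp_tmul,
        K.ip_left_smul]

theorem tensorIp_self_nonneg (x : K ⊗[ℂ] H) : 0 ≤ K.tensorIp H x x := by
  obtain ⟨s, rfl⟩ := TensorProduct.exists_finset x
  classical
  obtain ⟨m, B, hB⟩ := Matrix.posSemidef_iff_eq_sum_vecMulVec.mp
    (Matrix.posSemidef_gram ℂ (fun i : s => i.1.2))
  have hG : ∀ i j : s, inner ℂ i.1.2 j.1.2 = ∑ l, B l i * star (B l j) := fun i j => by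
    have := congrFun (congrFun hB i) j
    rw [Matrix.gram_apply] at this
    rw [this, Matrix.sum_apply]
    rfl
  have key : K.tensorIp H (∑ i ∈ s, i.1 ⊗ₜ[ℂ] i.2) (∑ i ∈ s, i.1 ⊗ₜ[ℂ] i.2)
      = ∑ l, K.ip (∑ i : s, star (B l i) • i.1.1) (∑ i : s, star (B l i) • i.1.1) := by
    rw [← Finset.sum_coe_sort s]
    simp only [map_sum, LinearMap.sum_apply, tensorIp_tmul, hG, Finset.sum_smul]
    have hr : ∀ l, K.ip (∑ i : s, star (B l i) • i.1.1) (∑ i : s, star (B l i) • i.1.1)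
        = ∑ j : s, ∑ i : s, (B l i * star (B l j)) • K.ip i.1.1 j.1.1 := fun l => by
      rw [← ipₛₗ_apply]
      simp only [map_sum, LinearMap.sum_apply, map_smul, map_smulₛₗ, LinearMap.smul_apply,
        ipₛₗ_apply, RCLike.star_def, RCLike.conj_conj]
      refine Finset.sum_congr rfl fun j _ => ?_
      rw [Finset.smul_sum]
      exact Finset.sum_congr rfl fun i _ => by rw [smul_smul, mul_comm]
    simp only [hr]
    symm
    rw [Finset.sum_comm]
    exact Finset.sum_congr rfl fun j _ => Finset.sum_comm
  rw [key]
  exact Finset.sum_nonneg fun l _ => K.ip_self_nonneg _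

/-- The algebraic tensor product `K ⊙ H`, with the `A`-`A`-bimodule structure of the first leg. -/
def tensor : PreCorr.{u, max v w} A where
  carrier := K ⊗[ℂ] H
  ip x y := K.tensorIp H x y
  ip_add_right _ y z := map_add _ y z
  ip_smul_right c _ y := map_smul _ c y
  ip_op_smul_right := K.tensorIp_op_smul_right H
  star_ip := K.star_tensorIp H
  ip_self_nonneg := K.tensorIp_self_nonneg H
  ip_left_smul := K.tensorIp_left_smul H

end tensor

section directSum

variable {ι : Type z} (V : ι → PreCorr.{u, v} A)

open Classical in
/-- `⟨x, y⟩ = ∑ i, ⟨x i, y i⟩` for finitely supported families. -/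
def directSumIp (x y : Π₀ i, V i) : A := ∑ i ∈ x.support ∪ y.support, (V i).ip (x i) (y i)

open Classical in
theorem directSumIp_eq (x y : Π₀ i, V i) (s : Finset ι) (h : x.support ⊆ s ∨ y.support ⊆ s) :
    directSumIp V x y = ∑ i ∈ s, (V i).ip (x i) (y i) := by
  have h0 : ∀ i, x i = 0 ∨ y i = 0 → (V i).ip (x i) (y i) = 0 := by
    rintro i (h | h) <;> rw [h] <;> simp [← ipₛₗ_apply]
  have h1 : directSumIp V x y = ∑ i ∈ (x.support ∪ y.support) ∪ s, (V i).ip (x i) (y i) := by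
    refine Finset.sum_subset Finset.subset_union_left fun i _ hi => h0 i ?_
    simp only [Finset.mem_union, DFinsupp.mem_support_iff, not_or, not_not] at hi
    exact Or.inl hi.1
  rw [h1]
  symm
  refine Finset.sum_subset Finset.subset_union_right fun i _ hi => h0 i ?_
  rcases h with h | h
  · exact Or.inl (DFinsupp.notMem_support_iff.1 fun h' => hi (h h'))
  · exact Or.inr (DFinsupp.notMem_support_iff.1 fun h' => hi (h h'))

open Classical in
/-- The algebraic direct sum `⨁ i, V i` with `⟨x, y⟩ = ∑ i, ⟨x i, y i⟩`. -/
def directSum : PreCorr.{u, max v z} A where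
  carrier := Π₀ i, V i
  bimodule := ⟨fun a b x => by ext i; exact smul_comm a b (x i)⟩
  leftTower := ⟨fun c a x => by ext i; exact smul_assoc c a (x i)⟩
  rightTower := ⟨fun c a x => by ext i; exact smul_assoc c a (x i)⟩
  ip := directSumIp V
  ip_add_right x y z := by
    rw [directSumIp_eq V x _ x.support (Or.inl subset_rfl),
      directSumIp_eq V x y x.support (Or.inl subset_rfl),
      directSumIp_eq V x z x.support (Or.inl subset_rfl), ← Finset.sum_add_distrib]
    exact Finset.sum_congr rfl fun i _ => (V i).ip_add_right _ _ _
  ip_smul_right c x y := by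
    rw [directSumIp_eq V x _ x.support (Or.inl subset_rfl),
      directSumIp_eq V x y x.support (Or.inl subset_rfl), Finset.smul_sum]
    exact Finset.sum_congr rfl fun i _ => (V i).ip_smul_right _ _ _
  ip_op_smul_right a x y := by
    rw [directSumIp_eq V x _ x.support (Or.inl subset_rfl),
      directSumIp_eq V x y x.support (Or.inl subset_rfl), Finset.sum_mul]
    exact Finset.sum_congr rfl fun i _ => (V i).ip_op_smul_right _ _ _
  star_ip x y := by
    rw [directSumIp_eq V x y x.support (Or.inl subset_rfl),
      directSumIp_eq V y x x.support (Or.inr subset_rfl), star_sum]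
    exact Finset.sum_congr rfl fun i _ => (V i).star_ip _ _
  ip_self_nonneg x := Finset.sum_nonneg fun i _ => (V i).ip_self_nonneg _
  ip_left_smul a x y := by
    rw [directSumIp_eq V _ y y.support (Or.inr subset_rfl),
      directSumIp_eq V x _ (x.support ∪ y.support) (Or.inl Finset.subset_union_left)]
    refine (Finset.sum_subset Finset.subset_union_right fun i _ hi => ?_).trans
      (Finset.sum_congr rfl fun i _ => (V i).ip_left_smul _ _ _)
    rw [DFinsupp.notMem_support_iff.1 hi]
    simp [← ipₛₗ_apply]

end directSum

end PreCorr

/-- A complex Hilbert space, bundled. -/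
structure HilbertSpace where
  carrier : Type w
  [normedAddCommGroup : NormedAddCommGroup carrier]
  [innerProductSpace : InnerProductSpace ℂ carrier]
  [completeSpace : CompleteSpace carrier]

attribute [instance] HilbertSpace.normedAddCommGroup HilbertSpace.innerProductSpace
  HilbertSpace.completeSpace

instance : CoeSort HilbertSpace.{w} (Type w) := ⟨HilbertSpace.carrier⟩

/-- The `ℓ^∞`-product of the `⋆`-algebras `B(H i)`. -/
def BoundedProd {ι : Type z} (H : ι → HilbertSpace.{w}) : Type (max z w) :=
  lp (fun i => H i →L[ℂ] H i) ∞

namespace BoundedProd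

variable {ι : Type z} (H : ι → HilbertSpace.{w})

instance : NonUnitalRing (BoundedProd H) :=
  inferInstanceAs (NonUnitalRing (lp (fun i => H i →L[ℂ] H i) ∞))

instance : Module ℂ (BoundedProd H) :=
  inferInstanceAs (Module ℂ (lp (fun i => H i →L[ℂ] H i) ∞))

instance : StarRing (BoundedProd H) :=
  inferInstanceAs (StarRing (lp (fun i => H i →L[ℂ] H i) ∞))

end BoundedProd

variable (A) in
/-- An object of the unitary ind-completion `Hilb(Bim_fgp(A))`, given by its values on `Irr(A)`,
which determine it up to isomorphism and can be prescribed arbitrarily. -/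
abbrev HilbObj := Irr A → HilbertSpace.{w}

/-- The realization `|H| = ⨁ k, k ⊗ H k` (`ℓ^2`-direct sum over `k` in `Irr(A)` of amplified
correspondences): the completion of the algebraic direct sum of the algebraic tensor products. -/
def HilbObj.realization (H : HilbObj.{u, w} A) : Corr.{u, max (u + 1) w} A :=
  (PreCorr.directSum fun k : Irr A => PreCorr.tensor k.rep.corr.toPreCorr (H k)).completion

/-- The Hilbert space object `H_E` of `E`, with `H_E(k) = Hom_{A-A}(k, E)`. -/
def Corr.hilbObj (E : Corr.{u, v} A) : HilbObj.{u, max u v} A :=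
  fun k => { carrier := HilbHom k.rep E }

/-- `E` belongs to `Hilb(Bim_fgp(A))`: it is isomorphic to the realization of an object. -/
def Corr.IsHilb (E : Corr.{u, v} A) : Prop :=
  ∃ H : HilbObj.{u, max u v} A, E.UnitarilyEquiv H.realization

variable (A) in
/-- A unital inclusion `A ⊂ D` of unital C⋆-algebras, with a faithful conditional expectation. -/
structure FaithfulInclusion (D : Type v) [CStarAlgebra D] [PartialOrder D] [StarOrderedRing D] where
  incl : A →⋆ₐ[ℂ] D
  expect : D →ₚ[ℂ] A
  incl_injective : Function.Injective incl
  expect_incl : ∀ a, expect (incl a) = a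
  expect_bimodule : ∀ a b d, expect (incl a * d * incl b) = a * expect d * b
  faithful : ∀ d, expect (star d * d) = 0 → d = 0

namespace FaithfulInclusion

variable {D : Type v} [CStarAlgebra D] [PartialOrder D] [StarOrderedRing D]
  (S : FaithfulInclusion A D)

/-- `D` as an `A`-`A`-bimodule, with `⟨x, y⟩ = E(x* y)`. -/
def preCorr : PreCorr.{u, v} A where
  carrier := D
  leftModule := Module.compHom D (S.incl : A →+* D)
  rightModule := Module.compHom D (S.incl : A →+* D).op
  leftTower := @IsScalarTower.mk ℂ A D _ (Module.compHom D (S.incl : A →+* D)).toSMul _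
    fun c a x => by
      change S.incl (c • a) * x = c • (S.incl a * x)
      rw [map_smul, smul_mul_assoc]
  rightTower := @IsScalarTower.mk ℂ Aᵐᵒᵖ D _ (Module.compHom D (S.incl : A →+* D).op).toSMul _
    fun c a x => by
      change x * S.incl (c • a.unop) = c • (x * S.incl a.unop)
      rw [map_smul, mul_smul_comm]
  bimodule := @SMulCommClass.mk A Aᵐᵒᵖ D (Module.compHom D (S.incl : A →+* D)).toSMul
    (Module.compHom D (S.incl : A →+* D).op).toSMul fun a b x => (mul_assoc _ _ _).symm
  ip x y := S.expect (star x * y)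
  ip_add_right x y z := by rw [mul_add, map_add]
  ip_smul_right c x y := by rw [mul_smul_comm, map_smul]
  ip_op_smul_right a x y := by
    change S.expect (star x * (y * S.incl a)) = S.expect (star x * y) * a
    have h := S.expect_bimodule 1 a (star x * y)
    rwa [map_one, one_mul, one_mul, mul_assoc] at h
  star_ip x y := by rw [← map_star, star_mul, star_star]
  ip_self_nonneg x := S.expect.map_nonneg (star_mul_self_nonneg x)
  ip_left_smul a x y := by
    change S.expect (star (S.incl a * x) * y) = S.expect (star x * (S.incl (star a) * y))
    rw [star_mul, map_star, mul_assoc]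

/-- The Hilbert completion of `D` for `⟨x, y⟩ = E(x* y)`, an `A`-`A`-correspondence. -/
def hilb : Corr.{u, v} A := S.preCorr.completion

/-- The completion `ℰ` of `D` is isomorphic to `|H_ℰ|` as a correspondence. -/
def IsIndInclusion : Prop := S.hilb.UnitarilyEquiv S.hilb.hilbObj.realization

end FaithfulInclusion

end

end CStarCorr

/-!
Call a correspondence `E` irreducibly generated if the images of all morphisms `k → E` with `k` in
`Irr(A)` span a dense subspace. By Schur's lemma, morphisms from inequivalent irreducibles have
orthogonal images, so the evaluation map `⨁ k ⊗ Hom(k, E) → E`, `x ⊗ f ↦ f x`, is isometric. Its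
range is the span of these images. Hence `E ≅ |H_E|` if and only if `E` is irreducibly generated,
and membership in `Hilb(Bim_fgp(A))` is the same condition.

An endomorphism of `E` acts on each `Hom(k, E)` by composition. If `E` is irreducibly generated,
this action is faithful and every uniformly bounded family of operators `S k` arises from it,
through the extension of `⨁ 1 ⊗ S k`; this identifies `End(E)` with `∏ B(Hom(k, E))`, and the
identities of the factors are the isotypic projections. Irreducible generation passes to images of
morphisms, hence to ranges of projections, and conversely (3) for `P = 1` says that `E` is
irreducibly generated.
-/

namespace CStarCorr

noncomputable section

open scoped TensorProduct ComplexOrder ENNReal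

variable {A : Type u} [CStarAlgebra A] [PartialOrder A] [StarOrderedRing A]

namespace PreCorr

section basic

variable (V : PreCorr.{u, v} A)

theorem ip_zero_left (x : V) : V.ip 0 x = 0 := by
  rw [← V.ipₛₗ_apply, map_zero, LinearMap.zero_apply]

theorem ip_zero_right (x : V) : V.ip x 0 = 0 := map_zero (V.ipₛₗ x)

theorem continuous_ip_comp {X : Type*} [TopologicalSpace X] {f g : X → V}
    (hf : Continuous f) (hg : Continuous g) : Continuous fun x => V.ip (f x) (g x) :=
  V.continuous_ip.comp (hf.prodMk hg)

theorem continuous_ip_right (x : V) : Continuous (V.ip x) :=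
  V.continuous_ip_comp continuous_const continuous_id

end basic

/-- An adjointable map of `A`-`A`-bimodules between pre-correspondences, with a chosen adjoint.
Without completeness, boundedness is not automatic and is part of the data. -/
structure AdjointableMap (V : PreCorr.{u, v} A) (W : PreCorr.{u, w} A) where
  map : V →L[ℂ] W
  adjoint : W →ₗ[ℂ] V
  map_smul : ∀ (a : A) x, map (a • x) = a • map x
  map_op_smul : ∀ (a : A) x, map (MulOpposite.op a • x) = MulOpposite.op a • map x
  ip_map : ∀ x y, W.ip (map x) y = V.ip x (adjoint y)

/-- A realization of the correspondence `K` as the separated completion of `V`. -/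
structure CompletionMap (V : PreCorr.{u, v} A) (K : Corr.{u, w} A) where
  map : V →ₗ[ℂ] K
  map_smul : ∀ (a : A) x, map (a • x) = a • map x
  map_op_smul : ∀ (a : A) x, map (MulOpposite.op a • x) = MulOpposite.op a • map x
  ip_map : ∀ x y, K.ip (map x) (map y) = V.ip x y
  denseRange : DenseRange map

namespace AdjointableMap

variable {V : PreCorr.{u, v} A} {W : PreCorr.{u, w} A}

theorem norm_adjoint_le (φ : AdjointableMap V W) (y : W) :
    ‖φ.adjoint y‖ ≤ ‖φ.map‖ * ‖y‖ := by
  rcases (norm_nonneg (φ.adjoint y)).eq_or_lt with h0 | hpos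
  · rw [← h0]
    positivity
  refine le_of_mul_le_mul_right ?_ hpos
  calc ‖φ.adjoint y‖ * ‖φ.adjoint y‖ = ‖W.ip (φ.map (φ.adjoint y)) y‖ := by
        rw [φ.ip_map, ← V.norm_sq, sq]
    _ ≤ ‖φ.map (φ.adjoint y)‖ * ‖y‖ := W.norm_ip_le _ _
    _ ≤ ‖φ.map‖ * ‖φ.adjoint y‖ * ‖y‖ := by gcongr; exact φ.map.le_opNorm _
    _ = ‖φ.map‖ * ‖y‖ * ‖φ.adjoint y‖ := by ring

/-- The identity, as an adjointable map. -/
protected def id (V : PreCorr.{u, v} A) : AdjointableMap V V where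
  map := .id ℂ V
  adjoint := .id
  map_smul _ _ := rfl
  map_op_smul _ _ := rfl
  ip_map _ _ := rfl

end AdjointableMap

namespace CompletionMap

universe v' w'

variable {V : PreCorr.{u, v} A} {W : PreCorr.{u, w} A} {K : Corr.{u, v'} A} {L : Corr.{u, w'} A}
  (ι : CompletionMap V K)

theorem isometry : Isometry ι.map :=
  AddMonoidHomClass.isometry_of_norm ι.map fun x => by
    rw [K.toPreCorr.norm_def, V.norm_def]
    exact congrArg (fun a : A => √‖a‖) (ι.ip_map x x)

/-- `CompletionMap.map`, as a bounded operator. -/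
def toCLM : V →L[ℂ] K := ⟨ι.map, ι.isometry.continuous⟩

/-- The continuous extension to `K` of a bounded operator on `V`. -/
def lift (f : V →L[ℂ] L) : K →L[ℂ] L := f.extend ι.toCLM

theorem lift_map (f : V →L[ℂ] L) (x : V) : ι.lift f (ι.map x) = f x :=
  ContinuousLinearMap.extend_eq f ι.denseRange ι.isometry.isUniformInducing x

theorem lift_smul {R : Type*} [SMul R V] [SMul R K] [SMul R L] [ContinuousConstSMul R K]
    [ContinuousConstSMul R L] {f : V →L[ℂ] L} {r : R} (hι : ∀ x, ι.map (r • x) = r • ι.map x)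
    (hf : ∀ x, f (r • x) = r • f x) (x : K) : ι.lift f (r • x) = r • ι.lift f x :=
  ι.denseRange.induction_on x
    (isClosed_eq ((ι.lift f).continuous.comp (continuous_const_smul r))
      ((ι.lift f).continuous.const_smul r))
    fun v => by rw [← hι, lift_map, lift_map, hf]

theorem ip_lift (κ : CompletionMap W L) {f : V →L[ℂ] L} {g : W →L[ℂ] K}
    (h : ∀ x y, L.ip (f x) (κ.map y) = K.ip (ι.map x) (g y)) (x : K) (y : L) :
    L.ip (ι.lift f x) y = K.ip x (κ.lift g y) := by
  refine ι.denseRange.induction_on x (isClosed_eq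
    (L.continuous_ip_comp (ι.lift f).continuous continuous_const)
    (K.continuous_ip_comp continuous_id continuous_const)) fun v => ?_
  refine κ.denseRange.induction_on y (isClosed_eq
    (L.continuous_ip_right _) ((K.continuous_ip_right _).comp (κ.lift g).continuous)) fun w => ?_
  rw [lift_map, lift_map, h]

/-- A correspondence is its own completion. -/
def refl (K : Corr.{u, v} A) : CompletionMap K.toPreCorr K where
  map := .id
  map_smul _ _ := rfl
  map_op_smul _ _ := rfl
  ip_map _ _ := rfl
  denseRange := denseRange_id

end CompletionMap

/-- The canonical map from `V` to its completion. -/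
def toCompletion (V : PreCorr.{u, v} A) : CompletionMap V V.completion where
  map :=
    { toFun := fun x => (show V.completion from (x : UniformSpace.Completion V))
      map_add' := UniformSpace.Completion.coe_add
      map_smul' := UniformSpace.Completion.coe_smul }
  map_smul := UniformSpace.Completion.coe_smul
  map_op_smul a := UniformSpace.Completion.coe_smul (MulOpposite.op a)
  ip_map := V.completionIp_coe
  denseRange := V.completionEquiv.surjective.denseRange.comp
    UniformSpace.Completion.denseRange_coe V.completionEquiv.continuous

namespace AdjointableMap

universe v' w'

variable {V : PreCorr.{u, v} A} {W : PreCorr.{u, w} A} {K : Corr.{u, v'} A} {L : Corr.{u, w'} A}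

/-- The extension of an adjointable map to the completions. -/
def extend (φ : AdjointableMap V W) (ι : CompletionMap V K) (κ : CompletionMap W L) :
    Corr.homSpace K L :=
  ⟨(ι.lift (κ.toCLM ∘L φ.map)).toLinearMap,
    fun a => ι.lift_smul (ι.map_smul a) fun x =>
      (congrArg κ.map (φ.map_smul a x)).trans (κ.map_smul a _),
    fun a => ι.lift_smul (ι.map_op_smul a) fun x =>
      (congrArg κ.map (φ.map_op_smul a x)).trans (κ.map_op_smul a _),
    κ.lift (ι.toCLM ∘L φ.adjoint.mkContinuous ‖φ.map‖ φ.norm_adjoint_le),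
    ι.ip_lift κ fun x y =>
      (κ.ip_map _ _).trans ((φ.ip_map x y).trans (ι.ip_map _ _).symm)⟩

theorem extend_apply (φ : AdjointableMap V W) (ι : CompletionMap V K) (κ : CompletionMap W L)
    (x : V) : (φ.extend ι κ).1 (ι.map x) = κ.map (φ.map x) := ι.lift_map _ x

theorem adj_extend_apply (φ : AdjointableMap V W) (ι : CompletionMap V K)
    (κ : CompletionMap W L) (y : W) :
    (Corr.adj (φ.extend ι κ)).1 (κ.map y) = ι.map (φ.adjoint y) := by
  refine Corr.ext_ip fun x => ι.denseRange.induction_on x (isClosed_eq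
    (K.continuous_ip_comp continuous_id continuous_const)
    (K.continuous_ip_comp continuous_id continuous_const)) fun v => ?_
  rw [Corr.ip_adj_right, extend_apply, κ.ip_map, φ.ip_map, ι.ip_map]

end AdjointableMap

end PreCorr

namespace Corr

variable {K : Corr.{u, v} A} {L : Corr.{u, w} A} {M : Corr.{u, z} A}

theorem continuous_hom (f : homSpace K L) : Continuous f.1 := by
  refine LinearMap.continuous_of_seq_closed_graph f.1 fun s x y hs hfs => ext_ip fun z => ?_
  have h_left := ((L.continuous_ip_right z).tendsto y).comp hfs
  have h_right := ((K.continuous_ip_right ((adj f).1 z)).tendsto x).comp hs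
  rw [← ip_adj_left]
  exact tendsto_nhds_unique h_left (h_right.congr fun n => ip_adj_left f z (s n))

/-- Composition of morphisms. -/
def comp (g : homSpace L M) (f : homSpace K L) : homSpace K M :=
  ⟨g.1 ∘ₗ f.1,
    fun a x => by rw [LinearMap.comp_apply, f.2.1, g.2.1, LinearMap.comp_apply],
    fun a x => by rw [LinearMap.comp_apply, f.2.2.1, g.2.2.1, LinearMap.comp_apply],
    fun x => (adj f).1 ((adj g).1 x),
    fun x y => by rw [LinearMap.comp_apply, ip_adj_right, ip_adj_right]⟩

theorem comp_apply (g : homSpace L M) (f : homSpace K L) (x : K) :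
    (comp g f).1 x = g.1 (f.1 x) := rfl

theorem UnitarilyEquiv.exists_surjective (h : UnitarilyEquiv K L) :
    ∃ f : homSpace L K, Function.Surjective f.1 := by
  obtain ⟨U, map_smul, map_op_smul, ip_map⟩ := h
  refine ⟨⟨U.symm.toLinearMap, fun a x => ?_, fun a x => ?_, U, fun x y => ?_⟩, U.symm.surjective⟩
  · exact U.symm_apply_eq.2 ((map_smul _ _).trans (by simp)).symm
  · exact U.symm_apply_eq.2 ((map_op_smul _ _).trans (by simp)).symm
  · rw [← ip_map]
    simp

theorem unitarilyEquiv_of_adj (u : homSpace K L) (hl : ∀ x, (adj u).1 (u.1 x) = x)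
    (hr : ∀ y, u.1 ((adj u).1 y) = y) : UnitarilyEquiv K L :=
  ⟨.ofLinearMap u.1 (adj u).1 (LinearMap.ext hr) (LinearMap.ext hl), u.2.1, u.2.2.1,
    fun x y => (ip_adj_right u x (u.1 y)).symm.trans (by rw [hl])⟩

end Corr

theorem PreCorr.CompletionMap.unitarilyEquiv {V : PreCorr.{u, z} A} {K : Corr.{u, v} A}
    {L : Corr.{u, w} A} (ι : CompletionMap V K) (κ : CompletionMap V L) :
    Corr.UnitarilyEquiv K L := by
  let u := (AdjointableMap.id V).extend ι κ
  have hu : ∀ v, u.1 (ι.map v) = κ.map v := AdjointableMap.extend_apply _ ι κ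
  have hadj : ∀ v, (Corr.adj u).1 (κ.map v) = ι.map v := AdjointableMap.adj_extend_apply _ ι κ
  refine Corr.unitarilyEquiv_of_adj u ?_ ?_
  · exact congrFun <| ι.denseRange.equalizer
      ((Corr.continuous_hom _).comp (Corr.continuous_hom _)) continuous_id <|
      funext fun v => by simp only [Function.comp_apply, hu, hadj]
  · exact congrFun <| κ.denseRange.equalizer
      ((Corr.continuous_hom _).comp (Corr.continuous_hom _)) continuous_id <|
      funext fun v => by simp only [Function.comp_apply, hu, hadj]

/-! ### Direct sums of amplifications -/

namespace PreCorr

/-- The algebraic direct sum of the amplifications `V i ⊗ H i`. -/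
abbrev amplifiedSum {ι : Type z} (V : ι → PreCorr.{u, v} A) (H : ι → Type w)
    [∀ i, NormedAddCommGroup (H i)] [∀ i, InnerProductSpace ℂ (H i)] :
    PreCorr.{u, max v w z} A :=
  directSum fun i => tensor (V i) (H i)

namespace amplifiedSum

variable {ι : Type z} (V : ι → PreCorr.{u, v} A) (H : ι → Type w)
  [∀ i, NormedAddCommGroup (H i)] [∀ i, InnerProductSpace ℂ (H i)]

open Classical in
/-- The elementary tensor `x ⊗ h` in the summand of index `i`. -/
def single (i : ι) : V i →ₗ[ℂ] H i →ₗ[ℂ] amplifiedSum V H :=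
  (TensorProduct.mk ℂ (V i) (H i)).compr₂ (DFinsupp.lsingle (M := fun i => V i ⊗[ℂ] H i) i)

variable {V H}

@[elab_as_elim]
theorem induction_on {p : amplifiedSum V H → Prop} (v : amplifiedSum V H) (zero : p 0)
    (add : ∀ v w, p v → p w → p (v + w)) (single : ∀ i x h, p (single V H i x h)) : p v := by
  classical
  refine DFinsupp.induction (p := p) v zero fun i t f _ _ hf => add _ _ ?_ hf
  refine TensorProduct.induction_on
    (motive := fun t => p (DFinsupp.single i t : Π₀ i, V i ⊗[ℂ] H i)) t ?_ (single i) ?_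
  · rw [DFinsupp.single_zero]
    exact zero
  · intro s t hs ht
    rw [DFinsupp.single_add]
    exact add _ _ hs ht

theorem smul_single (a : A) (i : ι) (x : V i) (h : H i) :
    a • single V H i x h = single V H i (a • x) h := by
  classical exact (DFinsupp.single_smul (β := fun i => V i ⊗[ℂ] H i) a (x ⊗ₜ h)).symm

theorem op_smul_single (a : A) (i : ι) (x : V i) (h : H i) :
    MulOpposite.op a • single V H i x h = single V H i (MulOpposite.op a • x) h := by
  classical
  exact (DFinsupp.single_smul (β := fun i => V i ⊗[ℂ] H i) (MulOpposite.op a) (x ⊗ₜ h)).symm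

variable (V H) in
/-- The component of index `i`. -/
def proj (i : ι) : amplifiedSum V H →ₗ[ℂ] V i ⊗[ℂ] H i :=
  DFinsupp.lapply (M := fun i => V i ⊗[ℂ] H i) i

theorem proj_single_same (i : ι) (x : V i) (h : H i) :
    proj V H i (single V H i x h) = x ⊗ₜ h := by
  classical exact DFinsupp.single_eq_same (β := fun i => V i ⊗[ℂ] H i)

theorem proj_single_of_ne {i j : ι} (hij : i ≠ j) (y : V j) (k : H j) :
    proj V H i (single V H j y k) = 0 := by
  classical exact DFinsupp.single_eq_of_ne (β := fun i => V i ⊗[ℂ] H i) hij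

theorem ip_single_left (i : ι) (x : V i) (h : H i) (v : amplifiedSum V H) :
    (amplifiedSum V H).ip (single V H i x h) v = (V i).tensorIp (H i) (x ⊗ₜ h) (proj V H i v) := by
  classical
  refine (directSumIp_eq (fun i => tensor (V i) (H i)) (single V H i x h) v {i}
    (Or.inl DFinsupp.support_single_subset)).trans ((Finset.sum_singleton _ _).trans ?_)
  exact congrArg (fun s => (V i).tensorIp (H i) s _) (proj_single_same i x h)

theorem ip_single_single (i : ι) (x y : V i) (h k : H i) :
    (amplifiedSum V H).ip (single V H i x h) (single V H i y k) = inner ℂ h k • (V i).ip x y := by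
  rw [ip_single_left, proj_single_same, tensorIp_tmul]

theorem ip_single_single_of_ne {i j : ι} (hij : i ≠ j) (x : V i) (h : H i) (y : V j) (k : H j) :
    (amplifiedSum V H).ip (single V H i x h) (single V H j y k) = 0 := by
  rw [ip_single_left, proj_single_of_ne hij, map_zero]

theorem norm_single (i : ι) (x : V i) (h : H i) : ‖single V H i x h‖ = ‖h‖ * ‖x‖ := by
  refine (pow_left_inj₀ (norm_nonneg _) (by positivity) two_ne_zero).1 ?_
  rw [mul_pow, norm_sq, norm_sq, ip_single_single, norm_smul, inner_self_eq_norm_sq_to_K]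
  simp

section lift

variable {M : Type*} [AddCommGroup M] [Module ℂ M]

open Classical in
/-- The linear map determined by bilinear maps on the summands. -/
def lift (φ : ∀ i, V i →ₗ[ℂ] H i →ₗ[ℂ] M) : amplifiedSum V H →ₗ[ℂ] M :=
  DFinsupp.lsum ℂ (M := fun i => V i ⊗[ℂ] H i) fun i => TensorProduct.lift (φ i)

theorem lift_single (φ : ∀ i, V i →ₗ[ℂ] H i →ₗ[ℂ] M) (i : ι) (x : V i) (h : H i) :
    lift φ (single V H i x h) = φ i x h := by
  classical
  exact (DFinsupp.lsum_single (M := fun i => V i ⊗[ℂ] H i) ℂ _ i _).trans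
    (TensorProduct.lift.tmul x h)

theorem lift_smul [Module A M] {φ : ∀ i, V i →ₗ[ℂ] H i →ₗ[ℂ] M}
    (hφ : ∀ i (a : A) x h, φ i (a • x) h = a • φ i x h) (a : A) (v : amplifiedSum V H) :
    lift φ (a • v) = a • lift φ v := by
  induction v using induction_on with
  | zero => simp
  | add v w hv hw => rw [smul_add, map_add, hv, hw, map_add, smul_add]
  | single i x h => rw [smul_single, lift_single, lift_single, hφ]

theorem lift_op_smul [Module Aᵐᵒᵖ M] {φ : ∀ i, V i →ₗ[ℂ] H i →ₗ[ℂ] M}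
    (hφ : ∀ i (a : A) x h, φ i (MulOpposite.op a • x) h = MulOpposite.op a • φ i x h) (a : A)
    (v : amplifiedSum V H) : lift φ (MulOpposite.op a • v) = MulOpposite.op a • lift φ v := by
  induction v using induction_on with
  | zero => simp
  | add v w hv hw => rw [smul_add, map_add, hv, hw, map_add, smul_add]
  | single i x h => rw [op_smul_single, lift_single, lift_single, hφ]

theorem hom_ext {f g : amplifiedSum V H →ₗ[ℂ] M}
    (h : ∀ i x y, f (single V H i x y) = g (single V H i x y)) : f = g := by
  ext v
  induction v using induction_on with
  | zero => rw [map_zero, map_zero]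
  | add v w hv hw => rw [map_add, map_add, hv, hw]
  | single i x y => exact h i x y

end lift

/-- The contraction `x ⊗ k ↦ ⟨h, k⟩ x` of the component of index `i`. -/
def contract (i : ι) (h : H i) : amplifiedSum V H →ₗ[ℂ] V i :=
  TensorProduct.lift ((LinearMap.lsmul ℂ (V i)).flip.compl₂ (innerₛₗ ℂ h)) ∘ₗ proj V H i

theorem ip_single_left_eq_ip_contract (i : ι) (x : V i) (h : H i) (v : amplifiedSum V H) :
    (amplifiedSum V H).ip (single V H i x h) v = (V i).ip x (contract i h v) := by
  rw [ip_single_left, contract, LinearMap.comp_apply]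
  induction proj V H i v with
  | zero => rw [map_zero, map_zero, ip_zero_right]
  | add s t hs ht => rw [map_add, map_add, ip_add_right, hs, ht]
  | tmul y k => exact ((V i).ip_smul_right _ x y).symm

/-- The map `x ↦ x ⊗ h` into the summand of index `i`. -/
def singleMap (i : ι) (h : H i) : AdjointableMap (V i) (amplifiedSum V H) where
  map := ((single V H i).flip h).mkContinuous ‖h‖ fun x => (norm_single i x h).le
  adjoint := contract i h
  map_smul a x := (smul_single a i x h).symm
  map_op_smul a x := (op_smul_single a i x h).symm
  ip_map x v := ip_single_left_eq_ip_contract i x h v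

variable (V) in
/-- The operator `⨁ 1 ⊗ S i`. -/
def amplify : (∀ i, H i →L[ℂ] H i) →ₐ[ℂ] Module.End ℂ (amplifiedSum V H) where
  toFun S := lift fun i => (single V H i).compl₂ (S i).toLinearMap
  map_one' := hom_ext fun i x h => lift_single _ i x h
  map_mul' S T := hom_ext fun i x h => by
    simp only [Module.End.mul_apply, lift_single, LinearMap.compl₂_apply]
    rfl
  map_zero' := hom_ext fun i x h =>
    (lift_single _ i x h).trans (map_zero (single V H i x))
  map_add' S T := hom_ext fun i x h => by
    simp only [LinearMap.add_apply, lift_single, LinearMap.compl₂_apply]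
    exact map_add _ (S i h) (T i h)
  commutes' c := hom_ext fun i x h =>
    (lift_single _ i x h).trans (map_smul (single V H i x) c h)

theorem amplify_single (S : ∀ i, H i →L[ℂ] H i) (i : ι) (x : V i) (h : H i) :
    amplify V S (single V H i x h) = single V H i x (S i h) :=
  lift_single (fun i => (single V H i).compl₂ (S i).toLinearMap) i x h

section complete

variable [∀ i, CompleteSpace (H i)]

theorem ip_amplify_left (S : ∀ i, H i →L[ℂ] H i) (v w : amplifiedSum V H) :
    (amplifiedSum V H).ip (amplify V S v) w = (amplifiedSum V H).ip v (amplify V (star S) w) := by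
  induction v using induction_on with
  | zero => rw [map_zero, ip_zero_left, ip_zero_left]
  | add v v' hv hv' => rw [map_add, ip_add_left, hv, hv', ip_add_left]
  | single i x h =>
    induction w using induction_on with
    | zero => rw [map_zero, ip_zero_right, ip_zero_right]
    | add w w' hw hw' => rw [map_add, ip_add_right, hw, hw', ip_add_right]
    | single j y k =>
      rw [amplify_single, amplify_single]
      obtain rfl | hij := eq_or_ne i j
      · rw [ip_single_single, ip_single_single, Pi.star_apply,
          ContinuousLinearMap.star_eq_adjoint, ContinuousLinearMap.adjoint_inner_right]
      · rw [ip_single_single_of_ne hij, ip_single_single_of_ne hij]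

/-- Each `C² - S i* S i` is of the form `R i* R i`, which exhibits the difference of the two sides
as `⟨R v, R v⟩` for `R = ⨁ 1 ⊗ R i`. -/
theorem ip_amplify_self_le (S : ∀ i, H i →L[ℂ] H i) {C : ℝ} (hS : ∀ i, ‖S i‖ ≤ C)
    (v : amplifiedSum V H) :
    (amplifiedSum V H).ip (amplify V S v) (amplify V S v) ≤
      C ^ 2 • (amplifiedSum V H).ip v v := by
  have h_le : ∀ i, star (S i) * S i ≤ algebraMap ℝ (H i →L[ℂ] H i) (C ^ 2) := fun i =>
    CStarAlgebra.star_mul_le_algebraMap_norm_sq.trans <| algebraMap_mono _ <| by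
      gcongr
      exact hS i
  choose R hR using fun i => CStarAlgebra.nonneg_iff_eq_star_mul_self.1 (sub_nonneg.2 (h_le i))
  have h_sum : star R * R + star S * S = algebraMap ℂ _ ((C ^ 2 : ℝ) : ℂ) :=
    funext fun i => (eq_add_of_sub_eq (hR i)).symm
  have h_ip : (amplifiedSum V H).ip (amplify V R v) (amplify V R v) +
      (amplifiedSum V H).ip (amplify V S v) (amplify V S v) =
        C ^ 2 • (amplifiedSum V H).ip v v := by
    rw [ip_amplify_left, ip_amplify_left, ← ip_add_right, ← Module.End.mul_apply,
      ← Module.End.mul_apply, ← map_mul, ← map_mul, ← LinearMap.add_apply, ← map_add, h_sum,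
      AlgHom.commutes, Module.algebraMap_end_apply, ip_smul_right, Complex.coe_smul]
  rw [← h_ip]
  exact le_add_of_nonneg_left (ip_self_nonneg _ _)

theorem norm_amplify_le (S : ∀ i, H i →L[ℂ] H i) {C : ℝ} (hC : 0 ≤ C) (hS : ∀ i, ‖S i‖ ≤ C)
    (v : amplifiedSum V H) : ‖amplify V S v‖ ≤ C * ‖v‖ := by
  have h_sq := CStarAlgebra.norm_le_norm_of_nonneg_of_le (ip_self_nonneg _ _)
    (ip_amplify_self_le S hS v)
  rw [norm_smul, ← norm_sq, ← norm_sq, Real.norm_of_nonneg (by positivity), ← mul_pow] at h_sq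
  exact (pow_le_pow_iff_left₀ (norm_nonneg _) (by positivity) two_ne_zero).1 h_sq

variable (V) in
/-- `⨁ 1 ⊗ S i` for a uniformly bounded family `S`, as an adjointable map. -/
def amplifyMap (S : ∀ i, H i →L[ℂ] H i) {C : ℝ} (hC : 0 ≤ C) (hS : ∀ i, ‖S i‖ ≤ C) :
    AdjointableMap (amplifiedSum V H) (amplifiedSum V H) where
  map := (amplify V S).mkContinuous C (norm_amplify_le S hC hS)
  adjoint := amplify V (star S)
  map_smul := lift_smul fun i a x h => (smul_single a i x (S i h)).symm
  map_op_smul := lift_op_smul fun i a x h => (op_smul_single a i x (S i h)).symm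
  ip_map := ip_amplify_left S

end complete

end amplifiedSum

end PreCorr

/-! ### Correspondences generated by irreducible objects -/

/-- Schur's lemma: `f* f` and `f f*` are scalars, so `f` is a multiple of a unitary. -/
theorem IrrObj.unitarilyEquiv_of_ne_zero {K L : IrrObj A} {f : HilbHom K L.corr} (hf : f ≠ 0) :
    Corr.UnitarilyEquiv K.corr L.corr := by
  let u : HilbHom K L.corr := ((‖f‖⁻¹ : ℝ) : ℂ) • f
  have hu : ‖u‖ = 1 := by
    rw [norm_smul, Complex.norm_real, norm_inv, norm_norm, inv_mul_cancel₀ (norm_ne_zero_iff.2 hf)]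
  have h_adj_comp : ∀ x, (Corr.adj u.toHom).1 (u.toHom.1 x) = x := fun x => by
    rw [HilbHom.adj_comp_apply, inner_self_eq_norm_sq_to_K, hu, RCLike.ofReal_one, one_pow,
      one_smul]
  obtain ⟨c, h_comp_adj⟩ := L.irreducible.scalar (Corr.comp u.toHom (Corr.adj u.toHom))
  have hc : c = 1 := by
    obtain ⟨x, hx⟩ := @exists_ne _ K.irreducible.nontrivial (0 : K.corr)
    have hux : u.toHom.1 x ≠ 0 := fun h => hx <| by rw [← h_adj_comp x, h, map_zero]
    refine smul_left_injective ℂ hux ?_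
    simp only [← h_comp_adj, Corr.comp_apply, h_adj_comp, one_smul]
  exact Corr.unitarilyEquiv_of_adj u.toHom h_adj_comp fun y => by
    rw [← Corr.comp_apply, h_comp_adj, hc, one_smul]

theorem Irr.hom_eq_zero {k l : Irr A} (hkl : k ≠ l) (f : HilbHom k.rep l.rep.corr) : f = 0 := by
  by_contra hf
  exact hkl (Quotient.out_equiv_out.1 (IrrObj.unitarilyEquiv_of_ne_zero hf))

theorem HilbHom.ip_apply_apply_of_ne {E : Corr.{u, v} A} {k l : Irr A} (hkl : k ≠ l)
    (f : HilbHom k.rep E) (g : HilbHom l.rep E) (x : k.rep.corr) (y : l.rep.corr) :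
    E.ip (f.toHom.1 x) (g.toHom.1 y) = 0 := by
  rw [← Corr.ip_adj_left, ← Corr.comp_apply, Irr.hom_eq_zero hkl (Corr.comp _ _)]
  exact l.rep.corr.ip_zero_left y

namespace HilbHom

/-- The evaluation pairing `(x, f) ↦ f x`. -/
def eval (K : IrrObj A) (E : Corr.{u, v} A) : K.corr →ₗ[ℂ] HilbHom K E →ₗ[ℂ] E :=
  LinearMap.mk₂ ℂ (fun x f => f.toHom.1 x) (fun _ _ f => map_add f.toHom.1 _ _)
    (fun _ _ f => map_smul f.toHom.1 _ _) (fun _ _ _ => rfl) (fun _ _ _ => rfl)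

end HilbHom

namespace HilbObj

open PreCorr

variable (H : HilbObj.{u, w} A)

/-- The algebraic part `⨁ k ⊗ H k` of `|H|`. -/
abbrev algebraic : PreCorr.{u, max (u + 1) w} A :=
  amplifiedSum (fun k : Irr A => k.rep.corr.toPreCorr) fun k => H k

/-- The morphism `x ↦ x ⊗ h` from `k` to `|H|`. -/
def inclusion (k : Irr A) (h : H k) : HilbHom k.rep H.realization :=
  (amplifiedSum.singleMap k h).extend (.refl k.rep.corr) H.algebraic.toCompletion

theorem inclusion_apply (k : Irr A) (h : H k) (x : k.rep.corr) :
    (H.inclusion k h).toHom.1 x =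
      H.algebraic.toCompletion.map (amplifiedSum.single _ _ k x h) :=
  AdjointableMap.extend_apply (amplifiedSum.singleMap (V := fun k : Irr A => k.rep.corr.toPreCorr)
    (H := fun k => H k) k h) (.refl k.rep.corr) H.algebraic.toCompletion x

end HilbObj

namespace Corr

section generation

variable (E : Corr.{u, v} A)

/-- The linear span of the images of all morphisms from irreducible objects to `E`. -/
def irrSpan : Submodule ℂ E :=
  Submodule.span ℂ {y | ∃ (k : Irr A) (f : HilbHom k.rep E) (x : k.rep.corr), f.toHom.1 x = y}

/-- `E` is generated, as a closed linear subspace, by the images of the irreducible objects of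
`Bim_fgp(A)`. -/
def IsIrrGenerated : Prop := Dense (E.irrSpan : Set E)

variable {E}

theorem apply_mem_irrSpan {k : Irr A} (f : HilbHom k.rep E) (x : k.rep.corr) :
    f.toHom.1 x ∈ E.irrSpan :=
  Submodule.subset_span ⟨k, f, x, rfl⟩

theorem map_irrSpan_le {F : Corr.{u, w} A} (f : homSpace E F) :
    E.irrSpan.map f.1 ≤ F.irrSpan := by
  rw [irrSpan, Submodule.map_span_le]
  rintro _ ⟨k, g, x, rfl⟩
  exact apply_mem_irrSpan (E := F) (comp f g.toHom) x

theorem IsIrrGenerated.of_surjective (hE : E.IsIrrGenerated) {F : Corr.{u, w} A}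
    (f : homSpace E F) (hf : Function.Surjective f.1) : F.IsIrrGenerated :=
  (hf.denseRange.dense_image (continuous_hom f) hE).mono (map_irrSpan_le f)

theorem IsIrrGenerated.of_unitarilyEquiv {F : Corr.{u, w} A} (hF : F.IsIrrGenerated)
    (h : E.UnitarilyEquiv F) : E.IsIrrGenerated := by
  obtain ⟨f, hf⟩ := h.exists_surjective
  exact hF.of_surjective f hf

open PreCorr

theorem isIrrGenerated_realization (H : HilbObj.{u, w} A) : H.realization.IsIrrGenerated := by
  refine H.algebraic.toCompletion.denseRange.mono ?_
  rintro _ ⟨v, rfl⟩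
  change H.algebraic.toCompletion.map v ∈ H.realization.irrSpan
  induction v using amplifiedSum.induction_on with
  | zero => exact (map_zero H.algebraic.toCompletion.map) ▸ zero_mem _
  | add v w hv hw => exact (map_add H.algebraic.toCompletion.map v w) ▸ add_mem hv hw
  | single k x h =>
    exact (H.inclusion_apply k h x) ▸ apply_mem_irrSpan (H.inclusion k h) x

variable (E)

/-- The algebraic part `⨁ k ⊗ Hom(k, E)` of `|H_E|`. -/
abbrev isotypicSum : PreCorr.{u, max (u + 1) v} A :=
  amplifiedSum (fun k : Irr A => k.rep.corr.toPreCorr) fun k => HilbHom k.rep E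

/-- The evaluation map `x ⊗ f ↦ f x`. -/
def eval : E.isotypicSum →ₗ[ℂ] E :=
  amplifiedSum.lift fun k => HilbHom.eval k.rep E

theorem eval_single (k : Irr A) (x : k.rep.corr) (f : HilbHom k.rep E) :
    E.eval (amplifiedSum.single _ _ k x f) = f.toHom.1 x :=
  amplifiedSum.lift_single (fun k : Irr A => HilbHom.eval k.rep E) k x f

theorem ip_eval (v w : E.isotypicSum) : E.ip (E.eval v) (E.eval w) = E.isotypicSum.ip v w := by
  induction v using amplifiedSum.induction_on with
  | zero => rw [map_zero, ip_zero_left, ip_zero_left]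
  | add v v' hv hv' => rw [map_add, ip_add_left, hv, hv', ip_add_left]
  | single k x f =>
    induction w using amplifiedSum.induction_on with
    | zero => rw [map_zero, ip_zero_right, ip_zero_right]
    | add w w' hw hw' => rw [map_add, ip_add_right, hw, hw', ip_add_right]
    | single l y g =>
      rw [eval_single, eval_single]
      obtain rfl | hkl := eq_or_ne k l
      · rw [amplifiedSum.ip_single_single, HilbHom.ip_apply_apply]
      · rw [amplifiedSum.ip_single_single_of_ne hkl, HilbHom.ip_apply_apply_of_ne hkl]

theorem irrSpan_le_range_eval : E.irrSpan ≤ LinearMap.range E.eval := by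
  refine Submodule.span_le.2 ?_
  rintro _ ⟨k, f, x, rfl⟩
  exact ⟨_, E.eval_single k x f⟩

variable {E}

/-- Evaluation realizes an irreducibly generated `E` as a completion of `⨁ k ⊗ Hom(k, E)`. -/
def IsIrrGenerated.evalCompletion (hE : E.IsIrrGenerated) : CompletionMap E.isotypicSum E where
  map := E.eval
  map_smul := amplifiedSum.lift_smul fun _ a x f => f.toHom.2.1 a x
  map_op_smul := amplifiedSum.lift_op_smul fun _ a x f => f.toHom.2.2.1 a x
  ip_map := E.ip_eval
  denseRange := hE.mono E.irrSpan_le_range_eval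

theorem unitarilyEquiv_realization_iff :
    E.UnitarilyEquiv E.hilbObj.realization ↔ E.IsIrrGenerated :=
  ⟨(isIrrGenerated_realization _).of_unitarilyEquiv,
    fun hE => hE.evalCompletion.unitarilyEquiv E.isotypicSum.toCompletion⟩

theorem isHilb_iff : E.IsHilb ↔ E.IsIrrGenerated :=
  ⟨fun ⟨H, hH⟩ => (isIrrGenerated_realization H).of_unitarilyEquiv hH,
    fun hE => ⟨_, unitarilyEquiv_realization_iff.2 hE⟩⟩

end generation

/-! ### Sums of orthogonal projections -/

section orthogonal

variable {E : Corr.{u, v} A} {ι : Type*} {P : ι → endAlg E}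

theorem isStarProjection_sum (hP : ∀ i, IsStarProjection (P i))
    (hPP : Pairwise fun i j => P i * P j = 0) (s : Finset ι) :
    IsStarProjection (∑ i ∈ s, P i) where
  isIdempotentElem := OrthogonalIdempotents.isIdempotentElem_sum
    ⟨fun i => (hP i).isIdempotentElem, hPP⟩
  isSelfAdjoint := isSelfAdjoint_sum s fun i _ => (hP i).isSelfAdjoint

theorem sum_apply (s : Finset ι) (x : E) : ∑ i ∈ s, (P i).1 x = (∑ i ∈ s, P i).1 x := by
  rw [AddSubmonoidClass.coe_finsetSum, LinearMap.sum_apply]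

theorem isClosed_setOf_hasSum (hP : ∀ i, IsStarProjection (P i))
    (hPP : Pairwise fun i j => P i * P j = 0) : IsClosed {x | HasSum (fun i => (P i).1 x) x} := by
  have h_lip (s : Finset ι) : LipschitzWith 1 fun x => ∑ i ∈ s, (P i).1 x := by
    simp only [sum_apply]
    exact AddMonoidHomClass.lipschitz_of_bound_nnnorm _ 1 fun x =>
      (norm_projection_le (isStarProjection_sum hP hPP s) x).trans_eq (one_mul _).symm
  exact (LipschitzWith.uniformEquicontinuous _ 1 h_lip).equicontinuous.isClosed_setOfPred_tendsto
    continuous_id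

theorem strictHasSum_one_of_dense (hP : ∀ i, IsStarProjection (P i))
    (hPP : Pairwise fun i j => P i * P j = 0) {G : Set E}
    (hG : Dense (Submodule.span ℂ G : Set E))
    (h : ∀ x ∈ G, HasSum (fun i => (P i).1 x) x) : StrictHasSum P 1 := by
  have h_span (x : E) (hx : x ∈ Submodule.span ℂ G) : HasSum (fun i => (P i).1 x) x := by
    induction hx using Submodule.span_induction with
    | mem x hx => exact h x hx
    | zero => simpa only [map_zero] using hasSum_zero
    | add x y _ _ hx hy => simpa only [map_add] using hx.add hy
    | smul c x _ hx => simpa only [map_smul] using hx.const_smul c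
  have h_all (x : E) : HasSum (fun i => (P i).1 x) x :=
    (isClosed_setOf_hasSum hP hPP).closure_subset_iff.2 h_span (hG x)
  refine ⟨h_all, fun x => ?_⟩
  simp only [(hP _).isSelfAdjoint.star_eq, star_one]
  exact h_all x

theorem StrictHasSum.comp_equiv {κ : Type*} {T : endAlg E} (h : StrictHasSum P T) (e : κ ≃ ι) :
    StrictHasSum (P ∘ e) T :=
  ⟨fun x => e.hasSum_iff.2 (h.1 x), fun x => e.hasSum_iff.2 (h.2 x)⟩

end orthogonal


/-! ### Endomorphisms of irreducibly generated correspondences -/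

section representation

variable {E : Corr.{u, v} A}

/-- An endomorphism, as a morphism. -/
def endHom (T : endAlg E) : homSpace E E := ⟨T.1, T.2⟩

/-- An endomorphism, as a bounded operator. -/
def endCLM (T : endAlg E) : E →L[ℂ] E := ⟨T.1, continuous_hom (endHom T)⟩

/-- Composition of a morphism from an irreducible object with an endomorphism. -/
def postcomp (T : endAlg E) {K : IrrObj A} (f : HilbHom K E) : HilbHom K E :=
  comp (endHom T) f.toHom

theorem norm_postcomp_le (T : endAlg E) {K : IrrObj A} (f : HilbHom K E) :
    ‖postcomp T f‖ ≤ ‖endCLM T‖ * ‖f‖ := by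
  have := K.irreducible.nontrivial
  obtain ⟨x, hx⟩ := exists_ne (0 : K.corr)
  refine le_of_mul_le_mul_right ?_ (norm_pos_iff.2 hx)
  calc ‖postcomp T f‖ * ‖x‖ = ‖endCLM T (f.toHom.1 x)‖ := (HilbHom.norm_apply _ x).symm
    _ ≤ ‖endCLM T‖ * ‖f.toHom.1 x‖ := ContinuousLinearMap.le_opNorm _ _
    _ = ‖endCLM T‖ * ‖f‖ * ‖x‖ := by rw [HilbHom.norm_apply, mul_assoc]

/-- The representation of `End_{A-A}(E)` on `Hom_{A-A}(K, E)` by composition. -/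
def homRep (E : Corr.{u, v} A) (K : IrrObj A) :
    endAlg E →⋆ₐ[ℂ] (HilbHom K E →L[ℂ] HilbHom K E) where
  toFun T := LinearMap.mkContinuous
    { toFun := postcomp T
      map_add' := fun f g => Subtype.ext (LinearMap.ext fun x => map_add T.1 _ _)
      map_smul' := fun c f => Subtype.ext (LinearMap.ext fun x => map_smul T.1 _ _) }
    ‖endCLM T‖ (norm_postcomp_le T)
  map_one' := rfl
  map_mul' _ _ := rfl
  map_zero' := rfl
  map_add' _ _ := rfl
  commutes' _ := rfl
  map_star' T := by
    rw [ContinuousLinearMap.star_eq_adjoint, ContinuousLinearMap.eq_adjoint_iff]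
    intro f g
    refine HilbHom.inner_eq fun x y => ?_
    rw [← HilbHom.ip_apply_apply]
    change E.ip ((star T).1 (f.toHom.1 x)) (g.toHom.1 y) = E.ip (f.toHom.1 x) (T.1 (g.toHom.1 y))
    rw [← ip_star_right, star_star]

theorem homRep_apply (T : endAlg E) (K : IrrObj A) (f : HilbHom K E) (x : K.corr) :
    (homRep E K T f).toHom.1 x = T.1 (f.toHom.1 x) := rfl

theorem norm_homRep_le (T : endAlg E) (K : IrrObj A) : ‖homRep E K T‖ ≤ ‖endCLM T‖ :=
  LinearMap.mkContinuous_norm_le _ (norm_nonneg _) (norm_postcomp_le T)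

namespace IsIrrGenerated

variable (hE : E.IsIrrGenerated)

include hE in
theorem ext_homRep {S T : endAlg E} (h : ∀ k : Irr A, homRep E k.rep S = homRep E k.rep T) :
    S = T := by
  refine Subtype.ext <| LinearMap.ext <| congrFun <|
    Continuous.ext_on hE (continuous_hom (endHom S)) (continuous_hom (endHom T)) <|
      LinearMap.eqOn_span ?_
  rintro _ ⟨k, f, x, rfl⟩
  exact congrArg (fun R => (HilbHom.toHom (R f)).1 x) (h k)

/-- The endomorphism that acts on `Hom_{A-A}(k, E)` as `S k`, for a uniformly bounded family `S`. -/
def ofFamily (S : ∀ k : Irr A, HilbHom k.rep E →L[ℂ] HilbHom k.rep E) {C : ℝ} (hC : 0 ≤ C)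
    (hS : ∀ k, ‖S k‖ ≤ C) : endAlg E :=
  let T := (PreCorr.amplifiedSum.amplifyMap (fun k : Irr A => k.rep.corr.toPreCorr) S hC hS).extend
    hE.evalCompletion hE.evalCompletion
  ⟨T.1, T.2⟩

theorem homRep_ofFamily (S : ∀ k : Irr A, HilbHom k.rep E →L[ℂ] HilbHom k.rep E) {C : ℝ}
    (hC : 0 ≤ C) (hS : ∀ k, ‖S k‖ ≤ C) (k : Irr A) :
    homRep E k.rep (hE.ofFamily S hC hS) = S k := by
  ext1 f
  refine Subtype.ext (LinearMap.ext fun x => ?_)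
  have h := PreCorr.AdjointableMap.extend_apply
    (PreCorr.amplifiedSum.amplifyMap (fun k : Irr A => k.rep.corr.toPreCorr) S hC hS)
    hE.evalCompletion hE.evalCompletion (PreCorr.amplifiedSum.single _ _ k x f)
  change (hE.ofFamily S hC hS).1 (E.eval _) = E.eval (PreCorr.amplifiedSum.amplify _ S _) at h
  rwa [PreCorr.amplifiedSum.amplify_single, eval_single, eval_single] at h

end IsIrrGenerated

/-- The action of `End_{A-A}(E)` on `H_E`, by bounded families of operators. -/
def toBoundedProd (E : Corr.{u, v} A) : endAlg E →⋆ₙₐ[ℂ] BoundedProd E.hilbObj where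
  toFun T := (⟨fun k => homRep E k.rep T, memℓp_infty ⟨‖endCLM T‖, Set.forall_mem_range.2
    fun k => norm_homRep_le T k.rep⟩⟩ : lp (fun k => E.hilbObj k →L[ℂ] E.hilbObj k) ∞)
  map_smul' c T := Subtype.ext (funext fun k => map_smul (homRep E k.rep) c T)
  map_zero' := Subtype.ext (funext fun k => map_zero (homRep E k.rep))
  map_add' S T := Subtype.ext (funext fun k => map_add (homRep E k.rep) S T)
  map_mul' S T := Subtype.ext (funext fun k => map_mul (homRep E k.rep) S T)
  map_star' T := Subtype.ext (funext fun k => map_star (homRep E k.rep) T)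

theorem IsIrrGenerated.bijective_toBoundedProd (hE : E.IsIrrGenerated) :
    Function.Bijective (toBoundedProd E) := by
  refine ⟨fun S T h => hE.ext_homRep fun k => congrFun (congrArg Subtype.val h) k,
    fun (S : lp (fun k => E.hilbObj k →L[ℂ] E.hilbObj k) ∞) => ?_⟩
  exact ⟨hE.ofFamily S.1 (norm_nonneg S) (lp.norm_apply_le_norm ENNReal.top_ne_zero S),
    Subtype.ext (funext (hE.homRep_ofFamily S.1 _ _))⟩

/-- `End_{A-A}(E) ≅ ∏ B(H_E(k))` for irreducibly generated `E`. -/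
def IsIrrGenerated.endEquivBoundedProd (hE : E.IsIrrGenerated) :
    endAlg E ≃⋆ₐ[ℂ] BoundedProd E.hilbObj :=
  .ofBijective (toBoundedProd E) hE.bijective_toBoundedProd

end representation

/-! ### The isotypic decomposition -/

section isotypic

variable {E : Corr.{u, v} A}

namespace IsIrrGenerated

variable (hE : E.IsIrrGenerated)

open Classical in
/-- The endomorphism that acts as `R` on `Hom_{A-A}(k, E)` and as `0` on `Hom_{A-A}(l, E)` for
`l ≠ k`. -/
def block (k : Irr A) (R : HilbHom k.rep E →L[ℂ] HilbHom k.rep E) : endAlg E :=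
  hE.ofFamily (Pi.single k R) (norm_nonneg R) fun l => by
    obtain rfl | hl := eq_or_ne l k
    · rw [Pi.single_eq_same]
    · rw [Pi.single_eq_of_ne hl, norm_zero]
      exact norm_nonneg R

open Classical in
theorem homRep_block_same (k : Irr A) (R : HilbHom k.rep E →L[ℂ] HilbHom k.rep E) :
    homRep E k.rep (hE.block k R) = R := by
  rw [block, homRep_ofFamily, Pi.single_eq_same]

open Classical in
theorem homRep_block_of_ne {k l : Irr A} (hl : l ≠ k)
    (R : HilbHom k.rep E →L[ℂ] HilbHom k.rep E) : homRep E l.rep (hE.block k R) = 0 := by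
  rw [block, homRep_ofFamily, Pi.single_eq_of_ne hl]

theorem eq_block {k : Irr A} {R : HilbHom k.rep E →L[ℂ] HilbHom k.rep E} {T : endAlg E}
    (h_same : homRep E k.rep T = R) (h_ne : ∀ l ≠ k, homRep E l.rep T = 0) : T = hE.block k R := by
  refine hE.ext_homRep fun l => ?_
  obtain rfl | hl := eq_or_ne l k
  · rw [h_same, homRep_block_same]
  · rw [h_ne l hl, homRep_block_of_ne _ hl]

theorem block_mul (k : Irr A) (R : HilbHom k.rep E →L[ℂ] HilbHom k.rep E) (T : endAlg E) :
    hE.block k R * T = hE.block k (R * homRep E k.rep T) :=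
  hE.eq_block (by rw [map_mul, homRep_block_same]) fun l hl => by
    rw [map_mul, homRep_block_of_ne _ hl, zero_mul]

theorem mul_block (k : Irr A) (R : HilbHom k.rep E →L[ℂ] HilbHom k.rep E) (T : endAlg E) :
    T * hE.block k R = hE.block k (homRep E k.rep T * R) :=
  hE.eq_block (by rw [map_mul, homRep_block_same]) fun l hl => by
    rw [map_mul, homRep_block_of_ne _ hl, mul_zero]

theorem star_block (k : Irr A) (R : HilbHom k.rep E →L[ℂ] HilbHom k.rep E) :
    star (hE.block k R) = hE.block k (star R) :=
  hE.eq_block (by rw [map_star, homRep_block_same]) fun l hl => by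
    rw [map_star, homRep_block_of_ne _ hl, star_zero]

/-- The projection onto the isotypic component of `k`. -/
def isotypicProj (k : Irr A) : endAlg E := hE.block k 1

theorem isStarProjection_isotypicProj (k : Irr A) : IsStarProjection (hE.isotypicProj k) where
  isIdempotentElem := by
    rw [IsIdempotentElem, isotypicProj, block_mul, homRep_block_same, one_mul]
  isSelfAdjoint := by rw [IsSelfAdjoint, isotypicProj, star_block, star_one]

theorem isotypicProj_mem_center (k : Irr A) :
    hE.isotypicProj k ∈ Subalgebra.center ℂ E.endAlg :=
  Subalgebra.mem_center_iff.2 fun T => by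
    rw [isotypicProj, mul_block, block_mul, one_mul, mul_one]

theorem isotypicProj_mul_isotypicProj_of_ne {k l : Irr A} (hkl : k ≠ l) :
    hE.isotypicProj k * hE.isotypicProj l = 0 := by
  refine hE.ext_homRep fun m => ?_
  rw [isotypicProj, isotypicProj, map_mul, map_zero]
  obtain rfl | hm := eq_or_ne m k
  · rw [homRep_block_of_ne _ hkl, mul_zero]
  · rw [homRep_block_of_ne _ hm, zero_mul]

/-- The action of the corner at an isotypic projection on `Hom_{A-A}(k, E)`. -/
def cornerRep (k : Irr A) :
    corner (hE.isotypicProj k) (hE.isStarProjection_isotypicProj k) →⋆ₙₐ[ℂ]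
      (HilbHom k.rep E →L[ℂ] HilbHom k.rep E) :=
  (homRep E k.rep).toNonUnitalStarAlgHom.comp (NonUnitalStarSubalgebraClass.subtype _)

theorem bijective_cornerRep (k : Irr A) : Function.Bijective (hE.cornerRep k) := by
  refine ⟨fun S T h => Subtype.ext ?_, fun R => ⟨⟨hE.block k R, ?_, ?_⟩, homRep_block_same hE k R⟩⟩
  · calc S.1 = hE.block k (1 * homRep E k.rep S.1) := S.2.1.symm.trans (hE.block_mul k 1 S.1)
      _ = hE.block k (1 * homRep E k.rep T.1) := congrArg (fun R => hE.block k (1 * R)) h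
      _ = T.1 := (hE.block_mul k 1 T.1).symm.trans T.2.1
  · rw [isotypicProj, block_mul, homRep_block_same, one_mul]
  · rw [isotypicProj, mul_block, homRep_block_same, mul_one]

/-- The corner at an isotypic projection is `B(H_E(k))`. -/
def cornerEquiv (k : Irr A) :
    corner (hE.isotypicProj k) (hE.isStarProjection_isotypicProj k) ≃⋆ₐ[ℂ]
      (E.hilbObj k →L[ℂ] E.hilbObj k) :=
  .ofBijective (hE.cornerRep k) (hE.bijective_cornerRep k)

theorem isotypicProj_apply_same (k : Irr A) (f : HilbHom k.rep E) (x : k.rep.corr) :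
    (hE.isotypicProj k).1 (f.toHom.1 x) = f.toHom.1 x := by
  rw [← homRep_apply, isotypicProj, homRep_block_same]
  rfl

theorem isotypicProj_apply_of_ne {k l : Irr A} (hl : l ≠ k) (f : HilbHom l.rep E)
    (x : l.rep.corr) : (hE.isotypicProj k).1 (f.toHom.1 x) = 0 := by
  rw [← homRep_apply, isotypicProj, homRep_block_of_ne _ hl]
  rfl

theorem strictHasSum_isotypicProj : StrictHasSum hE.isotypicProj 1 := by
  refine strictHasSum_one_of_dense hE.isStarProjection_isotypicProj
    (fun _ _ => hE.isotypicProj_mul_isotypicProj_of_ne) hE ?_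
  rintro _ ⟨l, f, x, rfl⟩
  simpa only [isotypicProj_apply_same] using
    hasSum_single (f := fun k => (hE.isotypicProj k).1 (f.toHom.1 x)) l
      fun k hk => hE.isotypicProj_apply_of_ne hk.symm f x

end IsIrrGenerated

end isotypic

section range

variable {E : Corr.{u, v} A}

/-- The morphism from `E` onto the range of a projection. -/
def rangeRestrict (Q : endAlg E) (hQ : IsStarProjection Q) : homSpace E (range Q hQ) :=
  ⟨LinearMap.rangeRestrict Q.1, fun a x => Subtype.ext (Q.2.1 a x),
    fun a x => Subtype.ext (Q.2.2.1 a x), Subtype.val (p := fun y => y ∈ LinearMap.range Q.1),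
    fun x y => by
      obtain ⟨_, z, rfl⟩ := y
      change E.ip (Q.1 x) (Q.1 z) = E.ip x (Q.1 z)
      have h_idem : Q.1 (Q.1 z) = Q.1 z := congrArg (fun R : endAlg E => R.1 z) hQ.isIdempotentElem
      rw [← ip_star_right, hQ.isSelfAdjoint.star_eq, h_idem]⟩

theorem unitarilyEquiv_range_one (h : IsStarProjection (1 : endAlg E)) :
    E.UnitarilyEquiv (range 1 h) :=
  ⟨.ofBijective (rangeRestrict 1 h).1
    ⟨fun _ _ hxy => congrArg Subtype.val hxy, LinearMap.surjective_rangeRestrict _⟩,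
    (rangeRestrict 1 h).2.1, (rangeRestrict 1 h).2.2.1, fun _ _ => rfl⟩

theorem isIrrGenerated_iff_forall_isHilb_range :
    E.IsIrrGenerated ↔ ∀ (Q : endAlg E) (hQ : IsStarProjection Q), (range Q hQ).IsHilb := by
  refine ⟨fun hE Q hQ => isHilb_iff.2 ?_, fun h => ?_⟩
  · exact hE.of_surjective (rangeRestrict Q hQ) (LinearMap.surjective_rangeRestrict Q.1)
  · exact (isHilb_iff.1 (h 1 (.one _))).of_unitarilyEquiv (unitarilyEquiv_range_one _)

end range

end Corr

end

end CStarCorr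

theorem theoremC_general {A : Type u} [CStarAlgebra A] [PartialOrder A] [StarOrderedRing A]
    (E : CStarCorr.Corr.{u, v} A) :
    (E.UnitarilyEquiv E.hilbObj.realization ↔
      ∃ (ι : Type (max (u + 1) v)) (P : ι → E.endAlg) (hP : ∀ i, IsStarProjection (P i)),
        (∀ i, P i ∈ Subalgebra.center ℂ E.endAlg) ∧
        Pairwise (fun i j => P i * P j = 0) ∧
        CStarCorr.Corr.StrictHasSum P 1 ∧
        (∀ i, ∃ H : CStarCorr.HilbertSpace.{max u v},
          Nonempty (CStarCorr.Corr.corner (P i) (hP i) ≃⋆ₐ[ℂ] (H →L[ℂ] H))) ∧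
        ∀ (Q : E.endAlg) (hQ : IsStarProjection Q), (CStarCorr.Corr.range Q hQ).IsHilb) ∧
    (E.UnitarilyEquiv E.hilbObj.realization →
      Nonempty (E.endAlg ≃⋆ₐ[ℂ] CStarCorr.BoundedProd E.hilbObj)) := by
  rw [CStarCorr.Corr.unitarilyEquiv_realization_iff]
  refine ⟨⟨fun hE => ?_, fun ⟨_, _, _, _, _, _, _, h_range⟩ => ?_⟩,
    fun hE => ⟨hE.endEquivBoundedProd⟩⟩
  · exact ⟨ULift.{v} (CStarCorr.Irr A), fun k => hE.isotypicProj k.down,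
      fun k => hE.isStarProjection_isotypicProj k.down,
      fun k => hE.isotypicProj_mem_center k.down,
      fun k l hkl => hE.isotypicProj_mul_isotypicProj_of_ne (ULift.down_injective.ne hkl),
      hE.strictHasSum_isotypicProj.comp_equiv Equiv.ulift,
      fun k => ⟨E.hilbObj k.down, ⟨hE.cornerEquiv k.down⟩⟩,
      CStarCorr.Corr.isIrrGenerated_iff_forall_isHilb_range.1 hE⟩
  · exact CStarCorr.Corr.isIrrGenerated_iff_forall_isHilb_range.2 h_range

theorem theoremC {A : Type u} {D : Type v} [CStarAlgebra A] [PartialOrder A] [StarOrderedRing A]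
    [Nontrivial A] [CStarAlgebra D] [PartialOrder D] [StarOrderedRing D]
    (hA : Subalgebra.center ℂ A = ⊥) (S : CStarCorr.FaithfulInclusion A D) :
    (S.IsIndInclusion ↔
      ∃ (ι : Type (max (u + 1) v)) (P : ι → S.hilb.endAlg) (hP : ∀ i, IsStarProjection (P i)),
        (∀ i, P i ∈ Subalgebra.center ℂ S.hilb.endAlg) ∧
        Pairwise (fun i j => P i * P j = 0) ∧
        CStarCorr.Corr.StrictHasSum P 1 ∧
        (∀ i, ∃ H : CStarCorr.HilbertSpace.{max u v},
          Nonempty (CStarCorr.Corr.corner (P i) (hP i) ≃⋆ₐ[ℂ] (H →L[ℂ] H))) ∧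
        ∀ (Q : S.hilb.endAlg) (hQ : IsStarProjection Q), (CStarCorr.Corr.range Q hQ).IsHilb) ∧
    (S.IsIndInclusion →
      Nonempty (S.hilb.endAlg ≃⋆ₐ[ℂ] CStarCorr.BoundedProd S.hilb.hilbObj)) :=
  theoremC_general S.hilb
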